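/- Let $\mathbb F_2=\langle a,b\rangle$ be the free group of rank 2, let $K$ be a finite or countably infinite set (with the discrete Borel structure) and let $\kappa$ be a probability measure on $K$. For a set $L$, $\mathbb F_2$ acts on $L^{\mathbb F_2}$ by the shift $(g\cdot x)(f)=x(g^{-1}f)$. Let $\kappa^{\mathbb F_2}$ and $\kappa^{\mathbb F_2/\langle b\rangle}$ be the product measures on $K^{\mathbb F_2}$ and on $K^{\mathbb F_2/\langle b\rangle}$, where $\mathbb F_2/\langle b\rangle$ is the set of left cosets $g\langle b\rangle$. Regard $\kappa^{\mathbb F_2/\langle b\rangle}\times\kappa^{\mathbb F_2}$ as a probability measure on $(K\times K)^{\mathbb F_2}$ by pushing it forward under the injection $$\Phi:K^{\mathbb F_2/\langle b\rangle}\times K^{\mathbb F_2}\to (K\times K)^{\mathbb F_2},\qquad \Phi(x,y)(g)=\bigl(x(g\langle b\rangle),\,y(g)\bigr).$$ Two probability-measure-preserving actions $G\curvearrowright(X,\mu)$ and $H\curvearrowright(Y,\nu)$ are called orbit equivalent if there are conull invariant measurable sets $X'\subseteq X$, $Y'\subseteq Y$ and a bijection $\phi:X'\to Y'$, measurable with measurable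 inverse, such that $\phi_*\mu=\nu$ and $\phi(G\cdot x)=H\cdot\phi(x)$ for every $x\in X'$. **Theorem.** The Bernoulli shift action $\mathbb F_2\curvearrowright(K^{\mathbb F_2},\kappa^{\mathbb F_2})$ is orbit equivalent to the shift action $\mathbb F_2\curvearrowright\bigl((K\times K)^{\mathbb F_2},\ \kappa^{\mathbb F_2/\langle b\rangle}\times\kappa^{\mathbb F_2}\bigr)$. -/

import Mathlib

open MeasureTheory

/-- A probability-measure-preserving action of the group `G` on `(X, μ)`. -/
structure PMPAction (G : Type*) [Group G] (X : Type*) [MeasurableSpace X] (μ : Measure X)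
    [IsProbabilityMeasure μ] where
  act : G → X → X
  act_one : ∀ x, act 1 x = x
  act_mul : ∀ g h x, act (g * h) x = act g (act h x)
  measurePreserving : ∀ g, MeasurePreserving (act g) μ μ

/-- Two p.m.p. actions are orbit equivalent if there are conull invariant measurable sets
`X' ⊆ X`, `Y' ⊆ Y` and an isomorphism of measure spaces `φ : X' → Y'` (a bimeasurable bijection
carrying `μ` to `ν`) which maps the `G`-orbit of each `x ∈ X'` exactly onto the `H`-orbit
of `φ x`. -/
def OrbitEquivalent {G H X Y : Type*} [Group G] [Group H] [MeasurableSpace X] [MeasurableSpace Y]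
    {μ : Measure X} {ν : Measure Y} [IsProbabilityMeasure μ] [IsProbabilityMeasure ν]
    (T : PMPAction G X μ) (S : PMPAction H Y ν) : Prop :=
  ∃ (X' : Set X) (Y' : Set Y) (φ : X' ≃ᵐ Y'),
    MeasurableSet X' ∧ MeasurableSet Y' ∧ μ X'ᶜ = 0 ∧ ν Y'ᶜ = 0 ∧
    (∀ g, ∀ x ∈ X', T.act g x ∈ X') ∧ (∀ h, ∀ y ∈ Y', S.act h y ∈ Y') ∧
    MeasurePreserving φ (μ.comap Subtype.val) (ν.comap Subtype.val) ∧
    ∀ x : X', {y : Y | ∃ z : X', (∃ g, T.act g x = z) ∧ (φ z : Y) = y}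
      = {y : Y | ∃ h, S.act h (φ x) = y}

/-- The shift `(g · x)(i) = x(g⁻¹ i)` on functions on a `G`-set `ι`. -/
def shift {G ι K : Type*} [Group G] [MulAction G ι] (g : G) (x : ι → K) : ι → K :=
  fun i => x (g⁻¹ • i)

theorem shift_one {G ι K : Type*} [Group G] [MulAction G ι] (x : ι → K) :
    shift (1 : G) x = x := by
  funext i
  simp [shift]

theorem shift_mul {G ι K : Type*} [Group G] [MulAction G ι] (g h : G) (x : ι → K) :
    shift (g * h) x = shift g (shift h x) := by
  funext i
  simp [shift, mul_smul]

theorem measurable_shift {G ι K : Type*} [Group G] [MulAction G ι] [MeasurableSpace K] (g : G) :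
    Measurable (shift g : (ι → K) → (ι → K)) :=
  measurable_pi_lambda _ fun i => measurable_pi_apply (g⁻¹ • i)

theorem measurePreserving_shift {G ι K : Type*} [Group G] [MulAction G ι] [MeasurableSpace K]
    (κ : Measure K) [IsProbabilityMeasure κ] (g : G) :
    MeasurePreserving (shift g : (ι → K) → (ι → K))
      (Measure.infinitePi fun _ => κ) (Measure.infinitePi fun _ => κ) := by
  refine ⟨measurable_shift g, ?_⟩
  have h := Measure.infinitePi_map_piCongrLeft (μ := fun _ : ι => κ) (MulAction.toPerm g : ι ≃ ι)
  convert h using 2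
  funext x i
  obtain ⟨j, rfl⟩ := (MulAction.toPerm g : ι ≃ ι).surjective i
  rw [MeasurableEquiv.coe_piCongrLeft, Equiv.piCongrLeft_apply_apply]
  simp [shift]

/-- The Bernoulli shift of `G` over the base space `(K, κ)`. -/
noncomputable def bernoulliShift (G : Type*) [Group G] {K : Type*} [MeasurableSpace K]
    (κ : Measure K) [IsProbabilityMeasure κ] :
    PMPAction G (G → K) (Measure.infinitePi fun _ : G => κ) where
  act := shift
  act_one := shift_one
  act_mul := shift_mul
  measurePreserving := measurePreserving_shift κ

/-- The map `Φ : K^(G/H) × K^G → (K × K)^G`, `Φ(x, y)(g) = (x(gH), y(g))`. -/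
def cosetPair {G K : Type*} [Group G] (H : Subgroup G) (p : (G ⧸ H → K) × (G → K)) : G → K × K :=
  fun g => (p.1 (g : G ⧸ H), p.2 g)

theorem measurable_cosetPair {G K : Type*} [Group G] [MeasurableSpace K] (H : Subgroup G) :
    Measurable (cosetPair H : (G ⧸ H → K) × (G → K) → (G → K × K)) :=
  measurable_pi_lambda _ fun g =>
    ((measurable_pi_apply (g : G ⧸ H)).comp measurable_fst).prodMk
      ((measurable_pi_apply g).comp measurable_snd)

/-- The measure `κ^(G/H) × κ^G`, regarded through `Φ` as a measure on `(K × K)^G`. -/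
noncomputable def cosetMeasure {G K : Type*} [Group G] [MeasurableSpace K] (H : Subgroup G)
    (κ : Measure K) [IsProbabilityMeasure κ] : Measure (G → K × K) :=
  ((Measure.infinitePi fun _ : G ⧸ H => κ).prod (Measure.infinitePi fun _ : G => κ)).map
    (cosetPair H)

instance {G K : Type*} [Group G] [MeasurableSpace K] (H : Subgroup G)
    (κ : Measure K) [IsProbabilityMeasure κ] : IsProbabilityMeasure (cosetMeasure H κ) :=
  Measure.isProbabilityMeasure_map (measurable_cosetPair H).aemeasurable

theorem measurePreserving_shift_cosetMeasure {G K : Type*} [Group G] [MeasurableSpace K]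
    (H : Subgroup G) (κ : Measure K) [IsProbabilityMeasure κ] (g : G) :
    MeasurePreserving (shift g : (G → K × K) → (G → K × K))
      (cosetMeasure H κ) (cosetMeasure H κ) := by
  refine ⟨measurable_shift g, ?_⟩
  have h := (measurePreserving_shift (ι := G ⧸ H) κ g).prod (measurePreserving_shift (ι := G) κ g)
  unfold cosetMeasure
  rw [Measure.map_map (measurable_shift g) (measurable_cosetPair H)]
  conv_rhs => rw [← h.map_eq, Measure.map_map (measurable_cosetPair H) h.measurable]
  rfl

/-- The shift action of `G` on `((K × K)^G, κ^(G/H) × κ^G)`. -/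
noncomputable def cosetShift {G K : Type*} [Group G] [MeasurableSpace K] (H : Subgroup G)
    (κ : Measure K) [IsProbabilityMeasure κ] :
    PMPAction G (G → K × K) (cosetMeasure H κ) where
  act := shift
  act_one := shift_one
  act_mul := shift_mul
  measurePreserving := measurePreserving_shift_cosetMeasure H κ

/-! Give each vertex `g` of the Cayley tree the pair `(z g, z (g * gb))`. Along a left coset of
`⟨ga⟩` these pairs are i.i.d. with law `κ × κ`, which is invariant under swapping the entries. A
greedy matching along each such line joins points with pair `(k, l)` to points with pair `(l, k)`.
By mixing and the swap symmetry, almost surely only pairs with equal entries stay unmatched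
(`ae_edgePair_mirror`). Let `mirror` be the resulting involution. Keep the `ga`-edges and let the
new `gb`-edge at `p` lead to `mirror p * gb`. The label `z` there is the second entry at `mirror p`,
hence the first entry at `p`: along the new `gb`-lines `z` is constant. Reading the pairs along the
new graph gives `rewiredPair z`.

The new graph is again a copy of the Cayley graph on the same vertices, so orbits go to orbits. The
matching depends only on the labels along `ga`-lines, which are kept, so rewiring the new labelling
undoes the change (`rewire_rewire`) and provides a measurable inverse.

It remains to find the law of `rewiredPair z` (`rewiredMeasure_eq_cosetMeasure`). A connected union
of `ga`-lines is enlarged by one line at a time (`IndepOn.union_aline`). Cut the tree at the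
`gb`-edge leading to the new line: the rewired labels on the two sides are functions of `z` on the
two sides, sharing only one value of `z` (`pos_mirror_mem_branch`, `pos_mirror_congr`). That value
is the first entry of the new line which its `gb`-coset already determines; the other entries of the
line are independent of it, hence of everything before. -/

set_option linter.unusedSectionVars false

/-! ### Reduced words and the branches of the Cayley tree -/

/-- The free group of rank two. -/
abbrev F2 : Type := FreeGroup (Fin 2)

/-- The first generator of the free group of rank two. -/
abbrev ga : F2 := FreeGroup.of 0

/-- The second generator of the free group of rank two. -/
abbrev gb : F2 := FreeGroup.of 1

namespace FreeGroup

variable {α : Type*} [DecidableEq α]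

theorem toWord_mul_mk_singleton (v : FreeGroup α) (l : α × Bool) :
    (v * mk [l]).toWord = v.toWord ++ [l] ∨
      v.toWord = (v * mk [l]).toWord ++ [(l.1, !l.2)] := by
  have hv : IsReduced v.toWord := isReduced_toWord
  have hmul : (v * mk [l]).toWord = reduce (v.toWord ++ [l]) := by
    rw [toWord_mul, toWord_mk, reduce_singleton]
  rcases List.eq_nil_or_concat v.toWord with h | ⟨w, x, h⟩
  · left; rw [hmul, h]; rfl
  · rw [List.concat_eq_append] at h
    by_cases hx : x = (l.1, !l.2)
    · right
      have h1 : v = mk w * mk [x] := by rw [mul_mk, ← h, mk_toWord]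
      have h2 : v * mk [l] = mk w := by
        rw [h1, hx, mul_assoc, mul_mk]
        have : mk ([(l.1, !l.2)] ++ [l]) = (1 : FreeGroup α) := by
          rw [one_eq_mk]
          exact Quot.sound (Red.Step.cons_not_rev (x := l.1) (b := l.2) (L := []))
        rw [this, mul_one]
      rw [h2, toWord_mk, h, hx]
      have : IsReduced w := hv.infix (by rw [h]; exact ⟨[], [x], by simp⟩)
      rw [this.reduce_eq]
    · left
      rw [hmul]
      apply IsReduced.reduce_eq
      rw [h] at hv ⊢
      unfold IsReduced at hv ⊢
      rw [List.isChain_append]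
      refine ⟨hv, List.isChain_singleton _, ?_⟩
      intro y hy z hz
      simp at hy hz
      subst hy; subst hz
      intro h1
      by_contra h2
      apply hx
      ext
      · exact h1
      · simp only
        cases h3 : x.2 <;> cases h4 : l.2 <;> simp_all

/-- Right multiplication by a letter alters only the end of a reduced word, so a first letter can
appear only on the empty word. In the tree, a branch is entered through a single edge. -/
theorem eq_one_of_mul_mk_mem_startsWith {v : FreeGroup α} {l w : α × Bool}
    (hv : v ∉ startsWith w) (hvl : v * mk [l] ∈ startsWith w) : v = 1 ∧ l = w := by
  simp only [startsWith, Set.mem_ofPred_eq] at hv hvl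
  rcases toWord_mul_mk_singleton v l with h | h
  · rw [h] at hvl
    by_cases h0 : v.toWord = []
    · rw [h0] at hvl
      exact ⟨toWord_eq_nil_iff.1 h0, by simpa using hvl⟩
    · rw [List.getElem?_append_left (List.length_pos_iff.2 h0)] at hvl
      exact absurd hvl hv
  · exfalso
    apply hv
    rw [h, List.getElem?_append_left, hvl]
    by_contra h1
    rw [List.getElem?_eq_none (by omega)] at hvl
    simp at hvl

theorem startsWith_of_mul_mk {v : FreeGroup α} {l w : α × Bool}
    (hv : v ∈ startsWith w) (hvl : v * mk [l] ∉ startsWith w) : v = mk [w] ∧ l = (w.1, !w.2) := by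
  have h := eq_one_of_mul_mk_mem_startsWith (l := (l.1, !l.2)) hvl (by
    rw [mul_assoc, mul_mk]
    have : mk ([l] ++ [(l.1, !l.2)]) = (1 : FreeGroup α) := by
      rw [one_eq_mk]
      exact Quot.sound (Red.Step.cons_not (x := l.1) (b := l.2) (L := []))
    rwa [this, mul_one])
  have hl : l = (w.1, !w.2) := by rw [← h.2]; simp
  refine ⟨?_, hl⟩
  have : v = (mk [l])⁻¹ := eq_inv_of_mul_eq_one_left h.1
  rw [this, hl, inv_mk]
  simp [invRev]

end FreeGroup

/-- The elements of the free group whose reduced word begins with `gb` (for `true`) or with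
`gb⁻¹` (for `false`). -/
def branch (d : Bool) : Set F2 := FreeGroup.startsWith ((1 : Fin 2), d)

theorem one_notMem_branch (d : Bool) : (1 : F2) ∉ branch d :=
  fun h => FreeGroup.startsWith.ne_one _ h rfl

theorem mul_a_mem_branch {v : F2} {d : Bool} : v * ga ∈ branch d ↔ v ∈ branch d := by
  constructor
  · intro h
    by_contra hv
    have := (FreeGroup.eq_one_of_mul_mk_mem_startsWith (l := (0, true)) hv h).2
    simp at this
  · intro h
    by_contra hv
    have := (FreeGroup.startsWith_of_mul_mk (l := (0, true)) h hv).2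
    simp at this

theorem mul_a_inv_mem_branch {v : F2} {d : Bool} : v * ga⁻¹ ∈ branch d ↔ v ∈ branch d := by
  rw [← mul_a_mem_branch (v := v * ga⁻¹), inv_mul_cancel_right]

theorem mul_a_zpow_mem_branch {v : F2} {d : Bool} (k : ℤ) :
    v * ga ^ k ∈ branch d ↔ v ∈ branch d := by
  induction k using Int.induction_on with
  | zero => simp
  | succ k ih => rw [zpow_add_one, ← mul_assoc, mul_a_mem_branch, ih]
  | pred k ih => rw [zpow_sub_one, ← mul_assoc, mul_a_inv_mem_branch, ih]

theorem a_zpow_notMem_branch {d : Bool} (k : ℤ) : ga ^ k ∉ branch d := by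
  rw [← one_mul (ga ^ k), mul_a_zpow_mem_branch]; exact one_notMem_branch d

theorem b_mem_branch : gb ∈ branch true := by
  simp [branch, FreeGroup.startsWith, FreeGroup.toWord_of]

theorem eq_one_of_mul_b_mem {v : F2} (h : v ∉ branch true) (h' : v * gb ∈ branch true) : v = 1 :=
  (FreeGroup.eq_one_of_mul_mk_mem_startsWith (l := (1, true)) h h').1

theorem mul_b_mem {v : F2} (h : v ∈ branch true) : v * gb ∈ branch true := by
  by_contra hv
  have := (FreeGroup.startsWith_of_mul_mk (l := (1, true)) h hv).2
  simp at this

theorem mul_b_inv_notMem {v : F2} (h : v ∉ branch true) : v * gb⁻¹ ∉ branch true := by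
  intro h'
  exact h (by simpa using mul_b_mem h')

theorem eq_b_of_mul_b_inv_notMem {v : F2} (h : v ∈ branch true) (h' : v * gb⁻¹ ∉ branch true) :
    v = gb := by
  have := eq_one_of_mul_b_mem h' (by simpa using h)
  exact (mul_inv_eq_one.1 this)

/-- The generator `gb` or its inverse. -/
def bsign (d : Bool) : F2 := FreeGroup.mk [((1 : Fin 2), d)]

theorem bsign_true : bsign true = gb := rfl
theorem bsign_false : bsign false = gb⁻¹ := rfl

theorem bsign_not (d : Bool) : bsign (!d) = (bsign d)⁻¹ := by
  cases d <;> simp [bsign_true, bsign_false]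

theorem bsign_mul_mem_branch {d : Bool} {v : F2} (h : v ∉ branch (!d)) :
    bsign d * v ∈ branch d :=
  FreeGroup.startsWith_mk_mul (w := (1, d)) v h

theorem eq_one_of_mul_bsign_mem {v : F2} {d e : Bool} (h : v ∉ branch d)
    (h' : v * bsign e ∈ branch d) : v = 1 ∧ e = d := by
  have := FreeGroup.eq_one_of_mul_mk_mem_startsWith (l := (1, e)) h h'
  simpa using this

/-- A nonzero power of `ga` does not cancel against a word beginning with `gb` or its inverse, so
the product begins with a letter `ga` or `ga⁻¹`. -/
theorem a_zpow_mul_branch {v : F2} {d e : Bool} {k : ℤ} (hv : v ∈ branch d)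
    (h : ga ^ k * v ∈ branch e) : k = 0 ∧ d = e := by
  have disj : ∀ {w w' : Fin 2 × Bool} {x : F2}, x ∈ FreeGroup.startsWith w →
      x ∈ FreeGroup.startsWith w' → w = w' := by
    intro w w' x h1 h2
    have h1' : x.toWord[0]? = some w := h1
    have h2' : x.toWord[0]? = some w' := h2
    rw [h1'] at h2'
    exact Option.some_injective _ h2'
  have hpos : ∀ n : ℕ, ga ^ (n + 1) * v ∈ FreeGroup.startsWith ((0 : Fin 2), true) := by
    intro n
    induction n with
    | zero =>
      rw [zero_add, pow_one]
      refine FreeGroup.startsWith_mk_mul (w := (0, true)) v fun h => ?_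
      have := disj hv h; simp at this
    | succ n ih =>
      rw [pow_succ', mul_assoc]
      refine FreeGroup.startsWith_mk_mul (w := (0, true)) _ fun h => ?_
      have := disj ih h; simp at this
  have hneg : ∀ n : ℕ, (ga⁻¹) ^ (n + 1) * v ∈ FreeGroup.startsWith ((0 : Fin 2), false) := by
    intro n
    induction n with
    | zero =>
      rw [zero_add, pow_one]
      refine FreeGroup.startsWith_mk_mul (w := (0, false)) v fun h => ?_
      have := disj hv h; simp at this
    | succ n ih =>
      rw [pow_succ', mul_assoc]
      refine FreeGroup.startsWith_mk_mul (w := (0, false)) _ fun h => ?_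
      have := disj ih h; simp at this
  rcases k with (_ | n) | n
  · refine ⟨rfl, ?_⟩
    have h0 : v ∈ branch e := by simpa using h
    simpa using disj hv h0
  · have := disj (hpos n) h; simp at this
  · have h' : (ga⁻¹) ^ (n + 1) * v ∈ branch e := by
      rw [inv_pow]; rwa [zpow_negSucc] at h
    have := disj (hneg n) h'; simp at this

theorem a_zpow_injective : Function.Injective fun k : ℤ => ga ^ k := by
  intro j k h
  simp only at h
  have := a_zpow_mul_branch (d := true) (e := true) (k := j - k) b_mem_branch (by
    rw [zpow_sub, h, mul_inv_cancel, one_mul]; exact b_mem_branch)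
  omega

theorem F2.induction_right {C : F2 → Prop} (one : C 1) (mul_a : ∀ g, C g → C (g * ga))
    (mul_a_inv : ∀ g, C g → C (g * ga⁻¹)) (mul_b : ∀ g, C g → C (g * gb))
    (mul_b_inv : ∀ g, C g → C (g * gb⁻¹)) (g : F2) : C g := by
  have key : ∀ g h, C h → C (h * g) := by
    intro g
    induction g using FreeGroup.induction_on with
    | C1 => intro h hh; simpa using hh
    | of i => fin_cases i; exacts [mul_a, mul_b]
    | inv_of i _ => fin_cases i; exacts [mul_a_inv, mul_b_inv]
    | mul x y hx hy => intro h hh; rw [← mul_assoc]; exact hy _ (hx _ hh)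
  simpa using key g 1 one

/-- An injective encoding of a countable type. -/
noncomputable def enc (K : Type*) [Countable K] : K → ℕ :=
  (exists_injective_nat K).choose

theorem enc_injective (K : Type*) [Countable K] : Function.Injective (enc K) :=
  (exists_injective_nat K).choose_spec

/-! ### The greedy matching along `ga`-lines and the rewired graph -/

section Matching

variable {K : Type*} [Countable K]

/-- `Matched u m p` holds if at stage `m` of the greedy matching along the `ga`-lines the point
`p`, labelled by a pair in increasing order, is matched with `p * ga ^ m`, labelled by the
swapped pair. -/
def Matched (u : F2 → K × K) : ℕ → F2 → Prop
  | m => fun p => enc K (u p).1 < enc K (u p).2 ∧ u (p * ga ^ m) = (u p).swap ∧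
      (∀ m', (_ : m' < m) → ¬ Matched u m' p) ∧
      ∀ m', (_ : m' < m) → ¬ Matched u m' (p * ga ^ m * (ga ^ m')⁻¹)
termination_by m => m

theorem matched_iff (u : F2 → K × K) (m : ℕ) (p : F2) :
    Matched u m p ↔ enc K (u p).1 < enc K (u p).2 ∧ u (p * ga ^ m) = (u p).swap ∧
      (∀ m' < m, ¬ Matched u m' p) ∧ ∀ m' < m, ¬ Matched u m' (p * ga ^ m * (ga ^ m')⁻¹) := by
  rw [Matched]

theorem Matched.unique_left {u : F2 → K × K} {m n : ℕ} {p : F2} (hm : Matched u m p)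
    (hn : Matched u n p) : m = n := by
  rcases lt_trichotomy m n with h | h | h
  · exact absurd hm (((matched_iff u n p).1 hn).2.2.1 m h)
  · exact h
  · exact absurd hn (((matched_iff u m p).1 hm).2.2.1 n h)

theorem Matched.unique_right {u : F2 → K × K} {m n : ℕ} {p q : F2} (hm : Matched u m p)
    (hn : Matched u n q) (h : p * ga ^ m = q * ga ^ n) : p = q := by
  have hp : p = q * ga ^ n * (ga ^ m)⁻¹ := by rw [← h, mul_inv_cancel_right]
  have hq : q = p * ga ^ m * (ga ^ n)⁻¹ := by rw [h, mul_inv_cancel_right]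
  rcases lt_trichotomy m n with h' | h' | h'
  · rw [hp] at hm
    exact absurd hm (((matched_iff u n q).1 hn).2.2.2 m h')
  · subst h'; exact mul_right_cancel h
  · rw [hq] at hn
    exact absurd hn (((matched_iff u m p).1 hm).2.2.2 n h')

/-- Stage `m` consults only labels on the `ga`-line of `p` and earlier stages at points of that
line. -/
theorem Matched.congr {u u' : F2 → K × K} {p p' : F2}
    (h : ∀ k : ℤ, u (p * ga ^ k) = u' (p' * ga ^ k)) (m : ℕ) :
    Matched u m p ↔ Matched u' m p' := by
  induction m using Nat.strong_induction_on generalizing p p' with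
  | _ m ih =>
    have h0 : u p = u' p' := by simpa using h 0
    have hm : u (p * ga ^ m) = u' (p' * ga ^ m) := by simpa using h m
    rw [matched_iff, matched_iff, h0, hm]
    refine and_congr_right fun _ => and_congr_right fun _ => and_congr ?_ ?_
    · exact forall₂_congr fun m' hm' => not_congr (ih m' hm' h)
    · refine forall₂_congr fun m' hm' => not_congr (ih m' hm' fun k => ?_)
      have := h (m - m' + k)
      simpa [zpow_add, zpow_sub, mul_assoc] using this

/-- The symmetric relation generated by the greedy matching. -/
def Partner (u : F2 → K × K) (p q : F2) : Prop :=
  ∃ m : ℕ, (q = p * ga ^ m ∧ Matched u m p) ∨ (p = q * ga ^ m ∧ Matched u m q)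

theorem Partner.symm {u : F2 → K × K} {p q : F2} (h : Partner u p q) : Partner u q p := by
  obtain ⟨m, h⟩ := h
  exact ⟨m, h.symm⟩

theorem Matched.lt {u : F2 → K × K} {m : ℕ} {p : F2} (h : Matched u m p) :
    enc K (u p).1 < enc K (u p).2 := ((matched_iff u m p).1 h).1

theorem Matched.swap {u : F2 → K × K} {m : ℕ} {p : F2} (h : Matched u m p) :
    u (p * ga ^ m) = (u p).swap := ((matched_iff u m p).1 h).2.1

/-- Left ends of matched pairs have increasing labels and right ends decreasing ones, so no point
plays both roles. -/
theorem Partner.unique {u : F2 → K × K} {p q q' : F2} (h : Partner u p q) (h' : Partner u p q') :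
    q = q' := by
  obtain ⟨m, ⟨rfl, h⟩ | ⟨h1, h⟩⟩ := h <;> obtain ⟨n, ⟨rfl, h'⟩ | ⟨h1', h'⟩⟩ := h'
  · rw [h.unique_left h']
  · have h2 := h'.swap
    rw [← h1'] at h2
    have h3 := h.lt
    have h4 := h'.lt
    rw [h2] at h3
    simp only [Prod.fst_swap, Prod.snd_swap] at h3
    omega
  · have h2 := h.swap
    rw [← h1] at h2
    have h3 := h.lt
    have h4 := h'.lt
    rw [h2] at h4
    simp only [Prod.fst_swap, Prod.snd_swap] at h4
    omega
  · exact h.unique_right h' (by rw [← h1, ← h1'])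

theorem Partner.swap {u : F2 → K × K} {p q : F2} (h : Partner u p q) : u q = (u p).swap := by
  obtain ⟨m, ⟨rfl, h⟩ | ⟨rfl, h⟩⟩ := h
  · exact h.swap
  · rw [h.swap, Prod.swap_swap]

theorem Partner.exists_zpow {u : F2 → K × K} {p q : F2} (h : Partner u p q) :
    ∃ k : ℤ, q = p * ga ^ k := by
  obtain ⟨m, ⟨rfl, h⟩ | ⟨rfl, h⟩⟩ := h
  · exact ⟨m, by simp⟩
  · exact ⟨-m, by simp⟩

theorem Partner.congr_imp {u u' : F2 → K × K} {p p' : F2}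
    (h : ∀ k : ℤ, u (p * ga ^ k) = u' (p' * ga ^ k)) {k : ℤ}
    (hp : Partner u p (p * ga ^ k)) : Partner u' p' (p' * ga ^ k) := by
  obtain ⟨m, ⟨h1, h2⟩ | ⟨h1, h2⟩⟩ := hp
  · refine ⟨m, Or.inl ⟨?_, (Matched.congr h m).1 h2⟩⟩
    rw [mul_left_cancel h1]
  · refine ⟨m, Or.inr ⟨?_, (Matched.congr (fun j => ?_) m).1 h2⟩⟩
    · rw [mul_assoc] at h1 ⊢
      rw [left_eq_mul] at h1 ⊢
      exact h1
    · rw [mul_assoc, mul_assoc, ← zpow_add, h]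

open Classical in
/-- The involution exchanging matched points and fixing unmatched points. -/
noncomputable def mirror (u : F2 → K × K) (p : F2) : F2 :=
  if h : ∃ q, Partner u p q then h.choose else p

theorem mirror_eq_of_partner {u : F2 → K × K} {p q : F2} (h : Partner u p q) : mirror u p = q := by
  have h' : ∃ q, Partner u p q := ⟨q, h⟩
  rw [mirror, dif_pos h']
  exact h'.choose_spec.unique h

theorem mirror_eq_self {u : F2 → K × K} {p : F2} (h : ¬ ∃ q, Partner u p q) : mirror u p = p := by
  rw [mirror, dif_neg h]

theorem mirror_mirror (u : F2 → K × K) (p : F2) : mirror u (mirror u p) = p := by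
  by_cases h : ∃ q, Partner u p q
  · obtain ⟨q, h⟩ := h
    rw [mirror_eq_of_partner h, mirror_eq_of_partner h.symm]
  · rw [mirror_eq_self h, mirror_eq_self h]

/-- Locality of the matching: it gives equivariance under shifts, invariance under rewiring, and
independence of labels off the line. -/
theorem mirror_congr {u u' : F2 → K × K} {p p' : F2}
    (h : ∀ k : ℤ, u (p * ga ^ k) = u' (p' * ga ^ k)) :
    ∃ k : ℤ, mirror u p = p * ga ^ k ∧ mirror u' p' = p' * ga ^ k := by
  by_cases hp : ∃ q, Partner u p q
  · obtain ⟨q, hq⟩ := hp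
    obtain ⟨k, rfl⟩ := hq.exists_zpow
    exact ⟨k, mirror_eq_of_partner hq, mirror_eq_of_partner (hq.congr_imp h)⟩
  · refine ⟨0, by simp [mirror_eq_self hp], ?_⟩
    rw [zpow_zero, mul_one]
    apply mirror_eq_self
    rintro ⟨q, hq⟩
    obtain ⟨k, rfl⟩ := hq.exists_zpow
    exact hp ⟨_, hq.congr_imp fun k => (h k).symm⟩

theorem exists_mirror_eq (u : F2 → K × K) (p : F2) : ∃ k : ℤ, mirror u p = p * ga ^ k := by
  obtain ⟨k, h, _⟩ := mirror_congr (u := u) (u' := u) (p := p) (p' := p) fun _ => rfl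
  exact ⟨k, h⟩

theorem shift_mul_apply {X : Type*} (g p : F2) (u : F2 → X) : shift g u (g * p) = u p := by
  simp [shift]

theorem shift_inv_apply {X : Type*} (g p : F2) (u : F2 → X) : shift g⁻¹ u p = u (g * p) := by
  simp [shift]

theorem mirror_shift (g : F2) (u : F2 → K × K) (p : F2) :
    mirror (shift g u) (g * p) = g * mirror u p := by
  obtain ⟨k, h1, h2⟩ := mirror_congr (u := shift g u) (u' := u) (p := g * p) (p' := p)
    fun k => by rw [mul_assoc, shift_mul_apply]
  rw [h1, h2, mul_assoc]

/-- `mirror u` as a permutation. -/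
noncomputable def mirrorPerm (u : F2 → K × K) : Equiv.Perm F2 where
  toFun := mirror u
  invFun := mirror u
  left_inv := mirror_mirror u
  right_inv := mirror_mirror u

/-- The rewired action on positions: `ga` moves as before, `gb` moves along a `gb`-edge
followed by a mirror step. -/
noncomputable def walk (u : F2 → K × K) : F2 →* Equiv.Perm F2 :=
  FreeGroup.lift ![Equiv.mulRight ga⁻¹, mirrorPerm u * Equiv.mulRight gb⁻¹]

/-- The end point of the rewired path with label `g` starting at `p`. -/
noncomputable def pos (u : F2 → K × K) (g p : F2) : F2 := walk u g⁻¹ p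

theorem pos_one (u : F2 → K × K) (p : F2) : pos u 1 p = p := by simp [pos]

theorem pos_mul (u : F2 → K × K) (g h p : F2) : pos u (g * h) p = pos u h (pos u g p) := by
  simp [pos]

theorem pos_a (u : F2 → K × K) (p : F2) : pos u ga p = p * ga := by
  simp [pos, walk, Equiv.Perm.inv_def]

theorem pos_a_inv (u : F2 → K × K) (p : F2) : pos u ga⁻¹ p = p * ga⁻¹ := by
  simp [pos, walk]

theorem pos_b (u : F2 → K × K) (p : F2) : pos u gb p = mirror u p * gb := by
  simp only [pos, walk, map_inv, FreeGroup.lift_apply_of]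
  rw [Equiv.Perm.inv_eq_iff_eq]
  simp [mirrorPerm, mirror_mirror]

theorem pos_b_inv (u : F2 → K × K) (p : F2) : pos u gb⁻¹ p = mirror u (p * gb⁻¹) := by
  simp [pos, walk, mirrorPerm]

theorem pos_a_zpow (u : F2 → K × K) (p : F2) (k : ℤ) : pos u (ga ^ k) p = p * ga ^ k := by
  induction k using Int.induction_on with
  | zero => simp [pos_one]
  | succ k ih => rw [zpow_add_one, pos_mul, ih, pos_a, mul_assoc]
  | pred k ih => rw [zpow_sub_one, pos_mul, ih, pos_a_inv, mul_assoc]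

theorem pos_shift (q : F2) (u : F2 → K × K) (g p : F2) :
    pos (shift q u) g (q * p) = q * pos u g p := by
  induction g using F2.induction_right with
  | one => simp [pos_one]
  | mul_a g ih => rw [pos_mul, pos_mul, ih, pos_a, pos_a, mul_assoc]
  | mul_a_inv g ih => rw [pos_mul, pos_mul, ih, pos_a_inv, pos_a_inv, mul_assoc]
  | mul_b g ih => rw [pos_mul, pos_mul, ih, pos_b, pos_b, mirror_shift, mul_assoc]
  | mul_b_inv g ih => rw [pos_mul, pos_mul, ih, pos_b_inv, pos_b_inv, mul_assoc, mirror_shift]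

/-- The labelling read off along the rewired action. -/
noncomputable def rewire (u : F2 → K × K) (g : F2) : K × K := u (pos u g 1)

/-- Moving the base point along a rewired path is a group shift of the rewired labelling; this is
why orbits correspond. -/
theorem rewire_shift_pos (u : F2 → K × K) (g : F2) :
    rewire (shift (pos u g 1)⁻¹ u) = shift g⁻¹ (rewire u) := by
  funext f
  have h := pos_shift (pos u g 1)⁻¹ u f (pos u g 1)
  rw [inv_mul_cancel] at h
  rw [rewire, h, shift_inv_apply, shift_inv_apply, mul_inv_cancel_left, rewire, pos_mul]

/-- Rewiring keeps the `ga`-lines together with their labels, hence also the matching. -/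
theorem pos_mirror_rewire (u : F2 → K × K) (q : F2) :
    pos u (mirror (rewire u) q) 1 = mirror u (pos u q 1) := by
  obtain ⟨k, h1, h2⟩ := mirror_congr (u := rewire u) (u' := u) (p := q) (p' := pos u q 1)
    fun k => by rw [rewire, pos_mul, pos_a_zpow]
  rw [h1, h2, pos_mul, pos_a_zpow]

/-- A twice rewired `gb`-step has two mirror steps before the original edge, and they cancel. -/
theorem pos_pos_rewire (u : F2 → K × K) (g : F2) : pos u (pos (rewire u) g 1) 1 = g := by
  induction g using F2.induction_right with
  | one => simp [pos_one]
  | mul_a g ih => rw [pos_mul (rewire u), pos_a, pos_mul, pos_a, ih]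
  | mul_a_inv g ih => rw [pos_mul (rewire u), pos_a_inv, pos_mul, pos_a_inv, ih]
  | mul_b g ih =>
    rw [pos_mul (rewire u), pos_b, pos_mul, pos_b, pos_mirror_rewire, ih, mirror_mirror]
  | mul_b_inv g ih =>
    rw [pos_mul (rewire u), pos_b_inv, pos_mirror_rewire, pos_mul, pos_b_inv, ih, mirror_mirror]

theorem rewire_rewire (u : F2 → K × K) : rewire (rewire u) = u := by
  funext g
  rw [rewire, rewire, pos_pos_rewire]

theorem pos_rewire_pos (u : F2 → K × K) (g : F2) : pos (rewire u) (pos u g 1) 1 = g := by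
  have := pos_pos_rewire (rewire u) g
  rwa [rewire_rewire] at this

theorem pos_injective (u : F2 → K × K) : Function.Injective fun g => pos u g 1 :=
  fun g h hgh => by rw [← pos_rewire_pos u g, show pos u g 1 = pos u h 1 from hgh, pos_rewire_pos]

end Matching

/-! ### The rewired walk on the two sides of a `gb`-edge -/

section Locality

variable {K : Type*} [Countable K]

theorem mirror_mem_branch {u : F2 → K × K} {p : F2} {d : Bool} :
    mirror u p ∈ branch d ↔ p ∈ branch d := by
  obtain ⟨k, hk⟩ := exists_mirror_eq u p
  rw [hk, mul_a_zpow_mem_branch]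

theorem rewire_shift_mirror (u : F2 → K × K) (g : F2) :
    rewire (shift (mirror u 1)⁻¹ u) g = u (pos u g (mirror u 1)) := by
  have h := pos_shift (mirror u 1)⁻¹ u g (mirror u 1)
  rw [inv_mul_cancel] at h
  rw [rewire, h, shift_inv_apply, mul_inv_cancel_left]

theorem pos_b_mirror_one (u : F2 → K × K) : pos u gb (mirror u 1) = gb := by
  rw [pos_b, mirror_mirror, one_mul]

theorem pos_mirror_injective (u : F2 → K × K) :
    Function.Injective fun g => pos u g (mirror u 1) := by
  obtain ⟨k, hk⟩ := exists_mirror_eq u 1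
  have : ∀ g, pos u g (mirror u 1) = pos u (ga ^ k * g) 1 := by
    intro g
    rw [pos_mul, pos_a_zpow, hk]
  intro g h hgh
  simp only [this] at hgh
  exact mul_left_cancel (pos_injective u hgh)

theorem mul_b_inv_notMem_iff {v : F2} (h : v ∈ branch true) :
    v * gb⁻¹ ∉ branch true ↔ v = gb := by
  refine ⟨eq_b_of_mul_b_inv_notMem h, ?_⟩
  rintro rfl
  rw [mul_inv_cancel]
  exact one_notMem_branch _

theorem mul_b_mem_iff {v : F2} (h : v ∉ branch true) : v * gb ∈ branch true ↔ v = 1 := by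
  refine ⟨eq_one_of_mul_b_mem h, ?_⟩
  rintro rfl
  rw [one_mul]
  exact b_mem_branch

/-- Mirror steps and `ga`-steps stay on one side of the tree edge from `1` to `gb`. The rewired edge
leaving the starting point `mirror u 1` crosses it, and by injectivity of the walk no other rewired
edge does. -/
theorem pos_mirror_mem_branch (u : F2 → K × K) (g : F2) :
    pos u g (mirror u 1) ∈ branch true ↔ g ∈ branch true := by
  induction g using F2.induction_right with
  | one => rw [pos_one, mirror_mem_branch]
  | mul_a g ih => rw [pos_mul, pos_a, mul_a_mem_branch, mul_a_mem_branch, ih]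
  | mul_a_inv g ih => rw [pos_mul, pos_a_inv, mul_a_inv_mem_branch, mul_a_inv_mem_branch, ih]
  | mul_b g ih =>
    rw [pos_mul, pos_b]
    rw [← mirror_mem_branch (u := u)] at ih
    by_cases hg : g ∈ branch true
    · exact iff_of_true (mul_b_mem (ih.2 hg)) (mul_b_mem hg)
    · rw [mul_b_mem_iff hg, mul_b_mem_iff (mt ih.1 hg)]
      constructor
      · intro h
        apply pos_mirror_injective u
        change pos u g (mirror u 1) = pos u 1 (mirror u 1)
        rw [pos_one, ← mirror_mirror u (pos u g (mirror u 1)), h]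
      · rintro rfl
        rw [pos_one, mirror_mirror]
  | mul_b_inv g ih =>
    rw [pos_mul, pos_b_inv, mirror_mem_branch]
    by_cases hg : g ∈ branch true
    · rw [← not_iff_not, mul_b_inv_notMem_iff hg, mul_b_inv_notMem_iff (ih.2 hg)]
      constructor
      · intro h
        apply pos_mirror_injective u
        simp only
        rw [h, pos_b_mirror_one]
      · rintro rfl
        exact pos_b_mirror_one u
    · exact iff_of_false (mul_b_inv_notMem (mt ih.1 hg)) (mul_b_inv_notMem hg)

theorem pos_mirror_congr {u u' : F2 → K × K} {g : F2}
    (h : ∀ p, (p ∈ branch true ↔ g ∈ branch true) → u p = u' p) :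
    pos u g (mirror u 1) = pos u' g (mirror u' 1) := by
  have line : ∀ p, (∀ q, (q ∈ branch true ↔ p ∈ branch true) → u q = u' q) →
      mirror u p = mirror u' p := by
    intro p hp
    obtain ⟨k, h1, h2⟩ := mirror_congr (u := u) (u' := u') (p := p) (p' := p)
      fun k => hp _ (mul_a_zpow_mem_branch k)
    rw [h1, h2]
  induction g using F2.induction_right with
  | one => rw [pos_one, pos_one]; exact line 1 h
  | mul_a g ih =>
    rw [pos_mul, pos_a, pos_mul, pos_a, ih fun p hp => h p (hp.trans mul_a_mem_branch.symm)]
  | mul_a_inv g ih =>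
    rw [pos_mul, pos_a_inv, pos_mul, pos_a_inv,
      ih fun p hp => h p (hp.trans mul_a_inv_mem_branch.symm)]
  | mul_b g ih =>
    by_cases hg1 : g = 1
    -- The walk enters the branch at `gb` whatever the labels are, so the labels on the side it
    -- leaves are forgotten.
    · rw [hg1, one_mul, pos_b_mirror_one, pos_b_mirror_one]
    · have side : g * gb ∈ branch true ↔ g ∈ branch true := by
        by_cases hg : g ∈ branch true
        · exact iff_of_true (mul_b_mem hg) hg
        · exact iff_of_false (fun h => hg1 (eq_one_of_mul_b_mem hg h)) hg
      rw [side] at h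
      rw [pos_mul, pos_b, pos_mul, pos_b, ← ih h,
        line _ fun q hq => h q (hq.trans (pos_mirror_mem_branch u g))]
  | mul_b_inv g ih =>
    by_cases hgb : g = gb
    · rw [hgb, mul_inv_cancel] at h ⊢
      rw [pos_one, pos_one]; exact line 1 h
    · have side : g * gb⁻¹ ∈ branch true ↔ g ∈ branch true := by
        by_cases hg : g ∈ branch true
        · exact iff_of_true (by by_contra h; exact hgb (eq_b_of_mul_b_inv_notMem hg h)) hg
        · exact iff_of_false (mul_b_inv_notMem hg) hg
      have mem := pos_mirror_mem_branch u (g * gb⁻¹)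
      rw [pos_mul, pos_b_inv, mirror_mem_branch] at mem
      rw [pos_mul, pos_b_inv, pos_mul, pos_b_inv, ← ih (by rwa [side] at h),
        line _ fun q hq => h q (hq.trans mem)]

/-- Expresses `mirror` without the choice in its definition, for the sake of measurability. -/
theorem mirror_eq_iff {u : F2 → K × K} {p q : F2} :
    mirror u p = q ↔ Partner u p q ∨ (p = q ∧ ¬ ∃ r, Partner u p r) := by
  by_cases h : ∃ r, Partner u p r
  · simp only [h, not_true_eq_false, and_false, or_false]
    refine ⟨?_, mirror_eq_of_partner⟩
    rintro rfl
    obtain ⟨r, hr⟩ := h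
    rwa [mirror_eq_of_partner hr]
  · have : ¬ Partner u p q := fun h' => h ⟨q, h'⟩
    simp [h, this, mirror_eq_self h]

end Locality

/-! ### Measurability of the rewiring -/

section Measurability

variable {K : Type*} [Countable K] [MeasurableSpace K] [MeasurableSingletonClass K]

theorem measurable_matched (m : ℕ) (p : F2) :
    Measurable fun u : F2 → K × K => Matched u m p := by
  induction m using Nat.strong_induction_on generalizing p with
  | _ m ih =>
    rw [show (fun u : F2 → K × K => Matched u m p) = fun u => _ from
      funext fun u => propext (matched_iff u m p)]
    refine Measurable.and ?_ (Measurable.and ?_ (Measurable.and ?_ ?_))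
    · exact (measurable_of_countable fun x : K × K => enc K x.1 < enc K x.2).comp
        (measurable_pi_apply p)
    · have h1 : Measurable fun u : F2 → K × K => (u (p * ga ^ m), u p) :=
        (measurable_pi_apply (p * ga ^ m)).prodMk (measurable_pi_apply p)
      exact (measurable_of_countable fun x : (K × K) × (K × K) => x.1 = x.2.swap).comp h1
    · exact Measurable.forall fun m' => Measurable.forall fun hm' => (ih m' hm' _).not
    · exact Measurable.forall fun m' => Measurable.forall fun hm' => (ih m' hm' _).not

theorem measurable_partner (p q : F2) :
    Measurable fun u : F2 → K × K => Partner u p q := by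
  unfold Partner
  refine Measurable.exists fun m => Measurable.or ?_ ?_
  · exact Measurable.and measurable_const (measurable_matched _ _)
  · exact Measurable.and measurable_const (measurable_matched _ _)

theorem measurable_mirror_eq (p q : F2) :
    Measurable fun u : F2 → K × K => mirror u p = q := by
  simp only [mirror_eq_iff]
  refine Measurable.or (measurable_partner _ _) (Measurable.and measurable_const ?_)
  exact (Measurable.exists fun r => measurable_partner _ _).not

theorem measurable_pos_eq (g p q : F2) :
    Measurable fun u : F2 → K × K => pos u g p = q := by
  have step : ∀ (g h : F2), (∀ q, Measurable fun u : F2 → K × K => pos u g p = q) →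
      (∀ p q, Measurable fun u : F2 → K × K => pos u h p = q) →
      ∀ q, Measurable fun u : F2 → K × K => pos u (g * h) p = q := by
    intro g h hg hh q
    have : (fun u : F2 → K × K => pos u (g * h) p = q) =
        fun u => ∃ r, pos u g p = r ∧ pos u h r = q := by
      funext u
      simp [pos_mul]
    rw [this]
    exact Measurable.exists fun r => Measurable.and (hg r) (hh r q)
  induction g using F2.induction_right generalizing q with
  | one => simp only [pos_one]; exact measurable_const
  | mul_a g ih =>
    refine step g _ ih (fun p q => ?_) q
    simp only [pos_a]; exact measurable_const
  | mul_a_inv g ih =>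
    refine step g _ ih (fun p q => ?_) q
    simp only [pos_a_inv]; exact measurable_const
  | mul_b g ih =>
    refine step g _ ih (fun p q => ?_) q
    simp only [pos_b, ← eq_mul_inv_iff_mul_eq]
    exact measurable_mirror_eq _ _
  | mul_b_inv g ih =>
    refine step g _ ih (fun p q => ?_) q
    simp only [pos_b_inv]
    exact measurable_mirror_eq _ _

theorem measurable_rewire : Measurable (rewire : (F2 → K × K) → F2 → K × K) := by
  refine measurable_pi_lambda _ fun g => measurable_to_countable' fun x => ?_
  have : (fun u : F2 → K × K => rewire u g) ⁻¹' {x} =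
      {u | ∃ q, pos u g 1 = q ∧ u q = x} := by
    ext u
    simp [rewire]
  rw [this]
  refine measurableSet_setOfPred.2
    (Measurable.exists fun q => Measurable.and (measurable_pos_eq _ _ _) ?_)
  exact (measurable_of_countable fun y : K × K => y = x).comp (measurable_pi_apply q)

end Measurability

/-! ### Independence in product measures and mixing along `ga` -/

theorem dependsOn_cylinder {ι K : Type*} (s : Finset ι) (S : Set (s → K)) :
    DependsOn (· ∈ (cylinder s S : Set (ι → K))) (s : Set ι) := by
  intro x y h
  have : s.restrict x = s.restrict y := by
    funext i
    exact h i i.2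
  simp only [mem_cylinder, this]

theorem measure_eq_tsum_inter_fiber {Ω C : Type*} [MeasurableSpace Ω] [Countable C]
    (μ : Measure Ω) (X : Ω → C) (hX : ∀ c, MeasurableSet {ω | X ω = c}) {S : Set Ω}
    (hS : MeasurableSet S) : μ S = ∑' c, μ (S ∩ {ω | X ω = c}) := by
  rw [← measure_iUnion]
  · congr 1
    ext ω; simp
  · intro p q hpq
    refine Set.disjoint_left.2 ?_
    rintro ω ⟨_, h1⟩ ⟨_, h2⟩
    exact hpq (h1.symm.trans h2)
  · exact fun c => hS.inter (hX c)

section ProductMeasure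

open ProbabilityTheory

variable {ι K : Type*} [MeasurableSpace K] (κ : Measure K) [IsProbabilityMeasure κ]

theorem infinitePi_inter_of_dependsOn {e f : Set (ι → K)} (he : MeasurableSet e)
    (hf : MeasurableSet f) {S T : Set ι} (hST : Disjoint S T)
    (heS : DependsOn (· ∈ e) S) (hfT : DependsOn (· ∈ f) T) :
    Measure.infinitePi (fun _ : ι => κ) (e ∩ f) =
      Measure.infinitePi (fun _ : ι => κ) e * Measure.infinitePi (fun _ : ι => κ) f := by
  classical
  obtain ⟨z₀⟩ : Nonempty (ι → K) := ⟨fun _ => (nonempty_of_isProbabilityMeasure κ).some⟩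
  have hind : iIndep (fun i : ι => MeasurableSpace.comap (fun z : ι → K => z i) inferInstance)
      (Measure.infinitePi (fun _ : ι => κ)) :=
    iIndepFun_infinitePi (X := fun _ x => x) (P := fun _ : ι => κ) fun _ => measurable_id
  have hdis := indep_iSup_of_disjoint (fun i => (measurable_pi_apply i).comap_le) hind hST
  have key : ∀ (e : Set (ι → K)) (S : Set ι), MeasurableSet e → DependsOn (· ∈ e) S →
      MeasurableSet[⨆ i ∈ S, MeasurableSpace.comap (fun z : ι → K => z i) inferInstance] e := by
    intro e S he heS
    -- Resetting the coordinates outside `S` to those of `z₀` does not affect membership in `e`, and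
    -- the reset map is measurable for the σ-algebra of `S`.
    have hext : Measurable[⨆ i ∈ S, MeasurableSpace.comap (fun z : ι → K => z i) inferInstance]
        fun z : ι → K => S.piecewise z z₀ := by
      refine @measurable_pi_lambda _ _ _ (_) _ _ fun i => ?_
      by_cases hi : i ∈ S
      · simp only [Set.piecewise_eq_of_mem _ _ _ hi]
        exact Measurable.of_comap_le (le_iSup₂_of_le i hi le_rfl)
      · simp only [Set.piecewise_eq_of_notMem _ _ _ hi]
        exact measurable_const
    have : e = (fun z : ι → K => S.piecewise z z₀) ⁻¹' e := by
      ext z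
      exact iff_of_eq (heS fun i hi => (Set.piecewise_eq_of_mem _ _ _ hi).symm)
    rw [this]
    exact hext he
  exact (Indep_iff _ _ _).1 hdis e f (key e S he heS) (key f T hf hfT)

theorem exists_cylinder_approx {A : Set (ι → K)} (hA : MeasurableSet A) {ε : ℝ} (hε : 0 < ε) :
    ∃ (s : Finset ι) (A' : Set (ι → K)), MeasurableSet A' ∧ DependsOn (· ∈ A') (s : Set ι) ∧
      Measure.infinitePi (fun _ : ι => κ) (symmDiff A A') < ENNReal.ofReal ε := by
  have hd := Measure.MeasureDense.of_generateFrom_isSetAlgebra_finite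
    (μ := Measure.infinitePi (fun _ : ι => κ))
    (isSetAlgebra_measurableCylinders (α := fun _ : ι => K)) generateFrom_measurableCylinders.symm
  obtain ⟨A', hA', hlt⟩ := hd.approx A hA (measure_ne_top _ _) ε hε
  obtain ⟨s, S, hS, rfl⟩ := (mem_measurableCylinders _).1 hA'
  exact ⟨s, _, hd.measurable _ hA', dependsOn_cylinder s S, hlt⟩

end ProductMeasure

section Mixing

variable {K : Type*} [MeasurableSpace K] (κ : Measure K) [IsProbabilityMeasure κ]

theorem exists_pow_disjoint (s t : Finset F2) :
    ∃ m : ℕ, ∀ p ∈ s, ∀ q ∈ t, p ≠ ga ^ m * q := by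
  classical
  have hfin : {m : ℕ | ∃ p ∈ s, ∃ q ∈ t, p = ga ^ m * q}.Finite := by
    have : {m : ℕ | ∃ p ∈ s, ∃ q ∈ t, p = ga ^ m * q} ⊆
        (fun m : ℕ => ga ^ m) ⁻¹' (Finset.image₂ (fun p q => p * q⁻¹) s t : Finset F2) := by
      rintro m ⟨p, hp, q, hq, h⟩
      simp only [Set.mem_preimage, Finset.coe_image₂, Set.mem_image2, Finset.mem_coe]
      exact ⟨p, hp, q, hq, by rw [h, mul_inv_cancel_right]⟩
    refine Set.Finite.subset (Set.Finite.preimage ?_ (Finset.finite_toSet _)) this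
    intro m _ n _ h
    have := a_zpow_injective (a₁ := m) (a₂ := n) (by simpa using h)
    exact_mod_cast this
  obtain ⟨m, hm⟩ := hfin.infinite_compl.nonempty
  refine ⟨m, fun p hp q hq h => hm ⟨p, hp, q, hq, h⟩⟩

/-- Mixing: approximate both sets by events on finitely many coordinates; a large power of `ga`
makes the supports disjoint and the events independent. -/
theorem null_of_forall_shift_inter_null {A B : Set (F2 → K)} (hA : MeasurableSet A)
    (hB : MeasurableSet B)
    (h : ∀ m : ℕ, Measure.infinitePi (fun _ : F2 => κ) (A ∩ shift (ga ^ m)⁻¹ ⁻¹' B) = 0) :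
    Measure.infinitePi (fun _ : F2 => κ) A * Measure.infinitePi (fun _ : F2 => κ) B = 0 := by
  set μ := Measure.infinitePi (fun _ : F2 => κ) with hμ
  -- The intersection of the approximating events has measure at most `2ε`, and returning to `A` and
  -- `B` costs `2ε + ε²`.
  have key : ∀ ε : ℝ, 0 < ε → μ.real A * μ.real B ≤ ε * (4 + ε) := by
    intro ε hε
    obtain ⟨s, A', hA', hAs, hAA⟩ := exists_cylinder_approx κ hA hε
    obtain ⟨t, B', hB', hBt, hBB⟩ := exists_cylinder_approx κ hB hε
    obtain ⟨m, hm⟩ := exists_pow_disjoint s t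
    have hpres := measurePreserving_shift (ι := F2) κ (ga ^ m)⁻¹
    rw [← hμ] at hAA hBB hpres
    have hTB : MeasurableSet (shift (ga ^ m)⁻¹ ⁻¹' B') := hpres.measurable hB'
    have hdep : DependsOn (· ∈ (shift (ga ^ m)⁻¹ ⁻¹' B' : Set (F2 → K)))
        ((fun q => ga ^ m * q) '' (t : Set F2)) := by
      intro x y hxy
      apply hBt
      intro i hi
      rw [shift_inv_apply, shift_inv_apply]
      exact hxy _ ⟨i, hi, rfl⟩
    have hind := infinitePi_inter_of_dependsOn κ hA' hTB (by
      rw [Set.disjoint_left]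
      rintro p hp ⟨q, hq, rfl⟩
      exact hm _ hp q hq rfl) hAs hdep
    rw [← hμ, hpres.measure_preimage hB'.nullMeasurableSet] at hind
    have hsub : A' ∩ shift (ga ^ m)⁻¹ ⁻¹' B' ⊆ (A ∩ shift (ga ^ m)⁻¹ ⁻¹' B) ∪
        (symmDiff A A' ∪ shift (ga ^ m)⁻¹ ⁻¹' (symmDiff B B')) := by
      rintro x ⟨hx1, hx2⟩
      by_cases h1 : x ∈ A
      · by_cases h2 : x ∈ shift (ga ^ m)⁻¹ ⁻¹' B
        · exact Or.inl ⟨h1, h2⟩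
        · exact Or.inr (Or.inr (Or.inr ⟨hx2, h2⟩))
      · exact Or.inr (Or.inl (Or.inr ⟨hx1, h1⟩))
    have hAr : μ.real (symmDiff A A') ≤ ε := ENNReal.toReal_le_of_le_ofReal hε.le hAA.le
    have hBr : μ.real (symmDiff B B') ≤ ε := ENNReal.toReal_le_of_le_ofReal hε.le hBB.le
    have hBr' : μ.real (shift (ga ^ m)⁻¹ ⁻¹' (symmDiff B B')) = μ.real (symmDiff B B') := by
      rw [measureReal_def, hpres.measure_preimage (hB.symmDiff hB').nullMeasurableSet,
        measureReal_def]
    have h0 : μ.real (A ∩ shift (ga ^ m)⁻¹ ⁻¹' B) = 0 := by rw [measureReal_def, h m]; rfl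
    have h1 : μ.real (A' ∩ shift (ga ^ m)⁻¹ ⁻¹' B') ≤ 0 + (ε + ε) := by
      refine (measureReal_mono hsub).trans ((measureReal_union_le _ _).trans ?_)
      rw [h0]
      gcongr
      refine (measureReal_union_le _ _).trans ?_
      rw [hBr']
      gcongr
    have h2 : μ.real (A' ∩ shift (ga ^ m)⁻¹ ⁻¹' B') = μ.real A' * μ.real B' := by
      rw [measureReal_def, hind, ENNReal.toReal_mul]; rfl
    have h3 : ∀ C C' : Set (F2 → K), μ.real (symmDiff C C') ≤ ε → μ.real C ≤ μ.real C' + ε := by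
      intro C C' hC
      have : C ⊆ C' ∪ symmDiff C C' := by
        intro x hx
        by_cases hx' : x ∈ C'
        · exact Or.inl hx'
        · exact Or.inr (Or.inl ⟨hx, hx'⟩)
      exact (measureReal_mono this).trans ((measureReal_union_le _ _).trans (by gcongr))
    have h4 := h3 A A' hAr
    have h5 := h3 B B' hBr
    have h6 : μ.real A' ≤ 1 := measureReal_le_one
    have h7 : μ.real B' ≤ 1 := measureReal_le_one
    have h8 : 0 ≤ μ.real A' := measureReal_nonneg
    have h9 : 0 ≤ μ.real B' := measureReal_nonneg
    calc μ.real A * μ.real B ≤ (μ.real A' + ε) * (μ.real B' + ε) := by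
          gcongr
      _ = μ.real A' * μ.real B' + (μ.real A' + μ.real B') * ε + ε * ε := by ring
      _ ≤ (0 + (ε + ε)) + (1 + 1) * ε + ε * ε := by
          rw [← h2]; gcongr
      _ = ε * (4 + ε) := by ring
  have hle : μ.real A * μ.real B ≤ 0 := by
    have hlim : Filter.Tendsto (fun ε : ℝ => ε * (4 + ε)) (nhdsWithin 0 (Set.Ioi 0)) (nhds 0) := by
      have : Continuous fun ε : ℝ => ε * (4 + ε) := by fun_prop
      have := (this.tendsto 0).mono_left (nhdsWithin_le_nhds (s := Set.Ioi 0))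
      simpa using this
    refine ge_of_tendsto hlim ?_
    filter_upwards [self_mem_nhdsWithin] with ε hε using key ε hε
  have h0 : μ.real A * μ.real B = 0 :=
    le_antisymm hle (mul_nonneg measureReal_nonneg measureReal_nonneg)
  rw [measureReal_def, measureReal_def, ← ENNReal.toReal_mul, ENNReal.toReal_eq_zero_iff] at h0
  exact h0.resolve_right (ENNReal.mul_ne_top (measure_ne_top _ _) (measure_ne_top _ _))

end Mixing

/-! ### Moving the base point and the rewired law -/

/-- The labelling of each vertex by the labels of the two ends of its outgoing `gb`-edge. -/
def edgePair {K : Type*} (z : F2 → K) : F2 → K × K := fun g => (z g, z (g * gb))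

theorem edgePair_shift {K : Type*} (g : F2) (z : F2 → K) :
    edgePair (shift g z) = shift g (edgePair z) := by
  funext h
  simp [edgePair, shift, mul_assoc]

section Turn

variable {K : Type*} [Countable K]

/-- The map moving the base point of a labelling to its mirror image. -/
noncomputable def turn (z : F2 → K) : F2 → K := shift (mirror (edgePair z) 1)⁻¹ z

theorem edgePair_turn (z : F2 → K) :
    edgePair (turn z) = shift (mirror (edgePair z) 1)⁻¹ (edgePair z) := by
  rw [turn, edgePair_shift]

theorem mirror_shift_inv_one (u : F2 → K × K) (p : F2) :
    mirror (shift p⁻¹ u) 1 = p⁻¹ * mirror u p := by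
  rw [← mirror_shift, inv_mul_cancel]

/-- The labelling of the rewired graph. -/
noncomputable def rewiredPair (z : F2 → K) : F2 → K × K := rewire (edgePair z)

theorem rewiredPair_shift_a (z : F2 → K) :
    rewiredPair (shift ga z) = shift ga (rewiredPair z) := by
  have := rewire_shift_pos (edgePair z) ga⁻¹
  rw [pos_a_inv, one_mul, inv_inv] at this
  rw [rewiredPair, edgePair_shift, this, rewiredPair]

/-- The shift moves the base point to `gb⁻¹` and `turn` to its mirror image, which together make one
rewired `gb⁻¹`-step. -/
theorem rewiredPair_turn_shift_b (z : F2 → K) :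
    rewiredPair (turn (shift gb z)) = shift gb (rewiredPair z) := by
  have := rewire_shift_pos (edgePair z) gb⁻¹
  rw [pos_b_inv, one_mul, inv_inv] at this
  rw [rewiredPair, edgePair_turn, edgePair_shift, ← shift_mul, rewiredPair, ← this]
  congr 2
  have h := mirror_shift_inv_one (edgePair z) gb⁻¹
  rw [inv_inv] at h
  rw [h, mul_inv_rev, inv_mul_cancel_right]

theorem rewiredPair_turn (z : F2 → K) (g : F2) :
    rewiredPair (turn z) g = edgePair z (pos (edgePair z) g (mirror (edgePair z) 1)) := by
  rw [rewiredPair, edgePair_turn, rewire_shift_mirror]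

theorem Partner.shift_inv {u : F2 → K × K} {p q : F2} (h : Partner u p q) :
    ∃ r, Partner (shift p⁻¹ u) 1 r := by
  obtain ⟨k, rfl⟩ := h.exists_zpow
  exact ⟨_, h.congr_imp (p' := 1) fun j => by rw [shift_inv_apply, one_mul]⟩

end Turn

section Rewiring

variable {K : Type*} [Countable K] [MeasurableSpace K] [MeasurableSingletonClass K]

theorem measurable_edgePair : Measurable (edgePair : (F2 → K) → F2 → K × K) :=
  measurable_pi_lambda _ fun g => (measurable_pi_apply g).prodMk (measurable_pi_apply (g * gb))

theorem measurable_rewiredPair : Measurable (rewiredPair : (F2 → K) → F2 → K × K) :=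
  measurable_rewire.comp measurable_edgePair

theorem measurableSet_mirror_edgePair (p : F2) :
    MeasurableSet {z : F2 → K | mirror (edgePair z) 1 = p} :=
  measurableSet_setOfPred.2 ((measurable_mirror_eq 1 p).comp measurable_edgePair)

theorem turn_preimage_inter (S : Set (F2 → K)) (p : F2) :
    turn ⁻¹' S ∩ {z | mirror (edgePair z) 1 = p} =
      shift p⁻¹ ⁻¹' (S ∩ {z | mirror (edgePair z) 1 = p⁻¹}) := by
  ext z
  have h : mirror (edgePair (shift p⁻¹ z)) 1 = p⁻¹ ↔ mirror (edgePair z) 1 = p := by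
    rw [edgePair_shift, mirror_shift_inv_one, mul_eq_left]
    constructor
    · intro h; rw [← h, mirror_mirror]
    · rintro rfl; rw [mirror_mirror]
  simp only [Set.mem_inter_iff, Set.mem_preimage, Set.mem_ofPred_eq, h]
  refine and_congr_left fun hp => ?_
  rw [turn, hp]

theorem measurable_turn : Measurable (turn : (F2 → K) → F2 → K) := by
  intro S hS
  have : turn ⁻¹' S = ⋃ p : F2, turn ⁻¹' S ∩ {z | mirror (edgePair z) 1 = p} := by
    ext z; simp
  rw [this]
  refine MeasurableSet.iUnion fun p => ?_
  rw [turn_preimage_inter]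
  exact measurable_shift _ (hS.inter (measurableSet_mirror_edgePair _))

variable (κ : Measure K) [IsProbabilityMeasure κ]

/-- Where the mirror image of the base point is `p`, `turn` is the shift by `p⁻¹`, and it lands
where the mirror image is `p⁻¹`. Thus `turn` permutes countably many pieces by measure-preserving
maps. -/
theorem measurePreserving_turn :
    MeasurePreserving (turn : (F2 → K) → F2 → K)
      (Measure.infinitePi fun _ => κ) (Measure.infinitePi fun _ => κ) := by
  refine ⟨measurable_turn, ?_⟩
  set μ := Measure.infinitePi fun _ : F2 => κ with hμ
  have part := fun S hS => measure_eq_tsum_inter_fiber (S := S) μ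
    (fun z => mirror (edgePair z) 1) measurableSet_mirror_edgePair hS
  ext S hS
  rw [Measure.map_apply measurable_turn hS, part _ (measurable_turn hS), part S hS,
    ← (Equiv.inv F2).tsum_eq]
  refine tsum_congr fun p => ?_
  rw [turn_preimage_inter, Equiv.inv_apply, inv_inv,
    (measurePreserving_shift (ι := F2) κ p).measure_preimage
      (hS.inter (measurableSet_mirror_edgePair _)).nullMeasurableSet]

/-- The law of the rewired labelling. -/
noncomputable def rewiredMeasure : Measure (F2 → K × K) :=
  (Measure.infinitePi fun _ : F2 => κ).map rewiredPair

instance : IsProbabilityMeasure (rewiredMeasure κ) :=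
  Measure.isProbabilityMeasure_map measurable_rewiredPair.aemeasurable

theorem measurePreserving_rewiredPair :
    MeasurePreserving rewiredPair (Measure.infinitePi fun _ : F2 => κ) (rewiredMeasure κ) :=
  ⟨measurable_rewiredPair, rfl⟩

/-- Under `rewiredPair` the shift by `ga` lifts to itself and the shift by `gb` to `turn` after the
shift; both lifts preserve the product measure. -/
theorem measurePreserving_shift_rewiredMeasure (g : F2) :
    MeasurePreserving (shift g) (rewiredMeasure κ) (rewiredMeasure κ) := by
  have hW := measurePreserving_rewiredPair κ
  have of_semiconj : ∀ (g : F2) (T : (F2 → K) → F2 → K),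
      MeasurePreserving T (Measure.infinitePi fun _ => κ) (Measure.infinitePi fun _ => κ) →
      (∀ z, rewiredPair (T z) = shift g (rewiredPair z)) →
      MeasurePreserving (shift g) (rewiredMeasure κ) (rewiredMeasure κ) := by
    intro g T hT h
    refine ⟨measurable_shift g, ?_⟩
    have h1 : (fun z : F2 → K => shift g (rewiredPair z)) = rewiredPair ∘ T :=
      funext fun z => (h z).symm
    conv_lhs => rw [rewiredMeasure, Measure.map_map (measurable_shift g) measurable_rewiredPair]
    rw [Function.comp_def, h1]
    exact (hW.comp hT).map_eq
  have inv : ∀ g : F2, MeasurePreserving (shift g) (rewiredMeasure κ) (rewiredMeasure κ) →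
      MeasurePreserving (shift g⁻¹) (rewiredMeasure κ) (rewiredMeasure κ) := by
    intro g hg
    refine ⟨measurable_shift _, ?_⟩
    conv_lhs => rw [← hg.map_eq, Measure.map_map (measurable_shift _) (measurable_shift _)]
    have : (shift g⁻¹ ∘ shift g : (F2 → K × K) → F2 → K × K) = id := by
      funext u
      rw [Function.comp_apply, ← shift_mul, inv_mul_cancel, shift_one, id]
    rw [this, Measure.map_id]
  induction g using FreeGroup.induction_on with
  | C1 => exact of_semiconj 1 id (MeasurePreserving.id _) fun z => (shift_one _).symm
  | of i =>
    fin_cases i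
    · exact of_semiconj ga _ (measurePreserving_shift κ ga) rewiredPair_shift_a
    · exact of_semiconj gb _ ((measurePreserving_turn κ).comp (measurePreserving_shift κ gb))
        rewiredPair_turn_shift_b
  | inv_of i h => exact inv _ h
  | mul x y hx hy =>
    convert hx.comp hy using 1
    funext u
    exact shift_mul x y u

/-! ### Almost every point with distinct labels is matched -/

theorem infinitePi_edgePair_one (x : K × K) :
    Measure.infinitePi (fun _ : F2 => κ) {z | edgePair z 1 = x} = κ {x.1} * κ {x.2} := by
  have h := Measure.infinitePi_map_eval_prod (P := fun _ : F2 => κ) (i := 1) (j := gb)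
    (FreeGroup.one_ne_of _)
  rw [← Measure.prod_prod, ← h, Measure.map_apply (by fun_prop)
    ((measurableSet_singleton _).prod (measurableSet_singleton _))]
  congr 1
  ext z
  simp [edgePair, Prod.ext_iff]

theorem measurable_exists_partner :
    Measurable fun z : F2 → K => ∃ r, Partner (edgePair z) 1 r :=
  (Measurable.exists fun r => measurable_partner 1 r).comp measurable_edgePair

theorem measurable_edgePair_one_eq (x : K × K) : Measurable fun z : F2 → K => edgePair z 1 = x :=
  (measurable_of_countable fun y : K × K => y = x).comp
    ((measurable_pi_apply 1).comp measurable_edgePair)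

/-- `turn` carries matched base points labelled `x` to matched ones labelled `x.swap`, so these
events are equally likely. The labels `x` and `x.swap` are equally likely as well; subtract. -/
theorem infinitePi_unmatched_swap (x : K × K) :
    Measure.infinitePi (fun _ : F2 => κ) {z | edgePair z 1 = x ∧ ¬ ∃ r, Partner (edgePair z) 1 r} =
      Measure.infinitePi (fun _ : F2 => κ)
        {z | edgePair z 1 = x.swap ∧ ¬ ∃ r, Partner (edgePair z) 1 r} := by
  set μ := Measure.infinitePi (fun _ : F2 => κ) with hμ
  have hle : ∀ x : K × K, μ {z | edgePair z 1 = x ∧ ∃ r, Partner (edgePair z) 1 r} ≤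
      μ {z | edgePair z 1 = x.swap ∧ ∃ r, Partner (edgePair z) 1 r} := by
    intro x
    have hm : MeasurableSet
        {z : F2 → K | edgePair z 1 = x.swap ∧ ∃ r, Partner (edgePair z) 1 r} :=
      measurableSet_setOfPred.2 ((measurable_edgePair_one_eq _).and measurable_exists_partner)
    rw [hμ, ← (measurePreserving_turn κ).measure_preimage hm.nullMeasurableSet, ← hμ]
    apply measure_mono
    rintro z ⟨hx, r, hr⟩
    simp only [Set.mem_preimage, Set.mem_ofPred_eq, edgePair_turn, mirror_eq_of_partner hr]
    refine ⟨?_, hr.symm.shift_inv⟩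
    rw [shift_inv_apply, mul_one, hr.swap, hx]
  have hsplit : ∀ x : K × K, μ {z | edgePair z 1 = x ∧ ∃ r, Partner (edgePair z) 1 r} +
      μ {z | edgePair z 1 = x ∧ ¬ ∃ r, Partner (edgePair z) 1 r} = κ {x.1} * κ {x.2} := by
    intro x
    rw [← infinitePi_edgePair_one κ x, ← hμ]
    exact measure_inter_add_sdiff {z | edgePair z 1 = x}
      (measurableSet_setOfPred.2 measurable_exists_partner)
  have heq := le_antisymm (hle x) (by simpa using hle x.swap)
  have h1 := hsplit x
  have h2 := hsplit x.swap
  rw [← heq, Prod.fst_swap, Prod.snd_swap, mul_comm (κ {x.2}), ← h1] at h2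
  exact ((ENNReal.add_right_inj (measure_ne_top _ _)).1 h2).symm

/-- An unmatched `x` and an unmatched `x.swap` to its right on one line would have been matched at
the stage equal to their distance. By mixing the product of the two probabilities is zero, and they
are equal. -/
theorem infinitePi_unmatched_of_lt (x : K × K) (hx : enc K x.1 < enc K x.2) :
    Measure.infinitePi (fun _ : F2 => κ)
      {z | edgePair z 1 = x ∧ ¬ ∃ r, Partner (edgePair z) 1 r} = 0 := by
  have hm : ∀ x : K × K, MeasurableSet
      {z : F2 → K | edgePair z 1 = x ∧ ¬ ∃ r, Partner (edgePair z) 1 r} := fun x =>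
    measurableSet_setOfPred.2 ((measurable_edgePair_one_eq _).and measurable_exists_partner.not)
  have h := null_of_forall_shift_inter_null κ (hm x) (hm x.swap) fun m => by
    convert measure_empty (μ := Measure.infinitePi (fun _ : F2 => κ))
    rw [Set.eq_empty_iff_forall_notMem]
    rintro z ⟨⟨h1, h2⟩, h3, h4⟩
    rw [edgePair_shift] at h3 h4
    rw [shift_inv_apply, mul_one] at h3
    apply h2
    refine ⟨ga ^ m, m, Or.inl ⟨(one_mul _).symm, ?_⟩⟩
    rw [matched_iff, h1, one_mul]
    refine ⟨hx, h3, fun m' _ hm' => h2 ⟨_, m', Or.inl ⟨rfl, hm'⟩⟩, fun m' _ hm' => h4 ?_⟩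
    have : Partner (edgePair z) (ga ^ m) (ga ^ m * (ga ^ m')⁻¹) :=
      ⟨m', Or.inr ⟨by rw [inv_mul_cancel_right], hm'⟩⟩
    exact this.shift_inv
  rw [← infinitePi_unmatched_swap, mul_self_eq_zero] at h
  exact h

theorem ae_edgePair_mirror (p : F2) : ∀ᵐ z ∂(Measure.infinitePi fun _ : F2 => κ),
    edgePair z (mirror (edgePair z) p) = (edgePair z p).swap := by
  have h1 : ∀ x : K × K, x.1 ≠ x.2 → ∀ᵐ z ∂(Measure.infinitePi fun _ : F2 => κ),
      ¬ (edgePair z 1 = x ∧ ¬ ∃ r, Partner (edgePair z) 1 r) := by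
    intro x hx
    rw [ae_iff]
    simp only [not_not]
    rcases lt_trichotomy (enc K x.1) (enc K x.2) with h | h | h
    · exact infinitePi_unmatched_of_lt κ x h
    · exact absurd (enc_injective K h) hx
    · rw [infinitePi_unmatched_swap]
      exact infinitePi_unmatched_of_lt κ x.swap h
  have h2 : ∀ᵐ z ∂(Measure.infinitePi fun _ : F2 => κ),
      edgePair z (mirror (edgePair z) 1) = (edgePair z 1).swap := by
    filter_upwards [ae_all_iff.2 fun x => ae_all_iff.2 fun hx => h1 x hx] with z hz
    by_cases hr : ∃ r, Partner (edgePair z) 1 r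
    · obtain ⟨r, hr⟩ := hr
      rw [mirror_eq_of_partner hr, hr.swap]
    · rw [mirror_eq_self hr]
      by_contra hne
      refine hz (edgePair z 1) (fun h => hne ?_) ⟨rfl, hr⟩
      ext
      · exact h
      · exact h.symm
  filter_upwards [(measurePreserving_shift (ι := F2) κ p⁻¹).quasiMeasurePreserving.ae h2] with z hz
  rwa [edgePair_shift, mirror_shift_inv_one, shift_inv_apply, shift_inv_apply,
    mul_inv_cancel_left, mul_one] at hz

/-- The rewired `gb`-edge ends at `mirror p * gb`, whose label is the second entry at `mirror p`;
the swap makes it the first entry at `p`. -/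
theorem ae_rewired_fst (g : F2) : ∀ᵐ w ∂rewiredMeasure κ, (w (g * gb)).1 = (w g).1 := by
  have hm : MeasurableSet {w : F2 → K × K | (w (g * gb)).1 = (w g).1} :=
    measurableSet_eq_fun (measurable_fst.comp (measurable_pi_apply _))
      (measurable_fst.comp (measurable_pi_apply _))
  rw [rewiredMeasure, ae_map_iff measurable_rewiredPair.aemeasurable hm]
  filter_upwards [ae_all_iff.2 fun p => ae_edgePair_mirror κ p] with z hz
  rw [rewiredPair, rewire, rewire, pos_mul, pos_b]
  have := congrArg Prod.snd (hz (pos (edgePair z) g 1))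
  exact this

end Rewiring

/-! ### Independence along a `ga`-line and across a `gb`-edge -/

theorem a_zpow_mem_zpowers_b {k : ℤ} (h : ga ^ k ∈ Subgroup.zpowers gb) : k = 0 := by
  obtain ⟨j, hj⟩ := Subgroup.mem_zpowers_iff.1 h
  have := congrArg (FreeGroup.lift ![Multiplicative.ofAdd (1 : ℤ), 1]) hj
  simpa [← ofAdd_zsmul] using this.symm

/-- The left coset of `⟨ga⟩` containing `g`. -/
def aline (g : F2) : Set F2 := {x | ∃ k : ℤ, x = g * ga ^ k}

theorem self_mem_aline (g : F2) : g ∈ aline g := ⟨0, by simp⟩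

theorem eq_of_mem_aline {g x y : F2} (hx : x ∈ aline g) (hy : y ∈ aline g)
    (h : x⁻¹ * y ∈ Subgroup.zpowers gb) : x = y := by
  obtain ⟨k, rfl⟩ := hx
  obtain ⟨l, rfl⟩ := hy
  have h1 : (g * ga ^ k)⁻¹ * (g * ga ^ l) = ga ^ (l - k) := by
    rw [sub_eq_neg_add, zpow_add, zpow_neg, mul_inv_rev, mul_assoc, inv_mul_cancel_left]
  rw [h1] at h
  have := a_zpow_mem_zpowers_b h
  rw [show l = k by omega]

section Boxes

variable {K : Type*}

/-- The coordinate `(w g).1` for `i = (g, false)` and `(w g).2` for `i = (g, true)`. -/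
def coord (i : F2 × Bool) (w : F2 → K × K) : K := cond i.2 (w i.1).2 (w i.1).1

/-- The box of labellings whose coordinates in `T` are constrained by `t`. -/
def box (T : Finset (F2 × Bool)) (t : F2 × Bool → Set K) : Set (F2 → K × K) :=
  {w | ∀ i ∈ T, coord i w ∈ t i}

theorem coord_congr {w w' : F2 → K × K} {i : F2 × Bool} (h : w i.1 = w' i.1) :
    coord i w = coord i w' := by
  rw [coord, coord, h]

/-- A set of coordinates is admissible if it contains at most one first coordinate from each
left coset of `⟨gb⟩`. -/
def Admissible (T : Finset (F2 × Bool)) : Prop :=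
  ∀ g h : F2, (g, false) ∈ T → (h, false) ∈ T → g⁻¹ * h ∈ Subgroup.zpowers gb → g = h

theorem Admissible.mono {S T : Finset (F2 × Bool)} (hT : Admissible T) (h : S ⊆ T) :
    Admissible S := fun g g' hg hg' => hT g g' (h hg) (h hg')

theorem admissible_of_subset_aline {T : Finset (F2 × Bool)} {g : F2}
    (h : ∀ i ∈ T, i.1 ∈ aline g) : Admissible T :=
  fun _ _ hx hy => eq_of_mem_aline (h _ hx) (h _ hy)

end Boxes

section Edge

variable {K : Type*} [Countable K] [MeasurableSpace K] [MeasurableSingletonClass K]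

theorem measurable_coord (i : F2 × Bool) : Measurable (coord i : (F2 → K × K) → K) := by
  obtain ⟨g, _ | _⟩ := i
  · exact measurable_fst.comp (measurable_pi_apply g)
  · exact measurable_snd.comp (measurable_pi_apply g)

theorem measurableSet_box (T : Finset (F2 × Bool)) (t : F2 × Bool → Set K) :
    MeasurableSet (box T t) := by
  have : box T t = ⋂ i ∈ T, coord i ⁻¹' t i := by ext w; simp [box]
  rw [this]
  exact Finset.measurableSet_biInter _ fun i _ => measurable_coord i (.of_discrete)

variable (κ : Measure K) [IsProbabilityMeasure κ]

/-- The first coordinates in `E`, one for each left coset of `⟨gb⟩`, and the second coordinates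
in `E` are independent with law `κ` under the rewired measure. -/
def IndepOn (E : Set F2) : Prop :=
  ∀ T : Finset (F2 × Bool), Admissible T → (∀ i ∈ T, i.1 ∈ E) → ∀ t : F2 × Bool → Set K,
    rewiredMeasure κ (box T t) = ∏ i ∈ T, κ (t i)

variable {κ}

theorem IndepOn.translate {E E' : Set F2} (hE : IndepOn κ E) (g : F2)
    (h : ∀ x ∈ E', g * x ∈ E) : IndepOn κ E' := by
  intro T hT hTE t
  let e : F2 × Bool ≃ F2 × Bool := (Equiv.mulLeft g).prodCongr (Equiv.refl Bool)
  have he : ∀ i, e i = (g * i.1, i.2) := fun _ => rfl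
  have hbox : box T t = shift g ⁻¹' box (T.map e.toEmbedding) (t ∘ e.symm) := by
    ext w
    simp only [box, Set.mem_preimage, Set.mem_ofPred_eq, Finset.mem_map_equiv]
    constructor
    · intro hw i hi
      have := hw _ hi
      have hc : coord (e (e.symm i)) (shift g w) = coord (e.symm i) w := by
        rw [he]; simp only [coord, shift_mul_apply]
      rw [Equiv.apply_symm_apply] at hc
      rwa [hc]
    · intro hw i hi
      have := hw (e i) (by simpa using hi)
      have hc : coord (e i) (shift g w) = coord i w := by
        rw [he]; simp only [coord, shift_mul_apply]
      rw [hc] at this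
      simpa using this
  rw [hbox, (measurePreserving_shift_rewiredMeasure κ g).measure_preimage
    (measurableSet_box _ _).nullMeasurableSet, hE]
  · simp
  · intro x y hx hy hxy
    simp only [Finset.mem_map, Equiv.coe_toEmbedding, he, Prod.mk.injEq, Prod.exists] at hx hy
    obtain ⟨x, _, hx, rfl, rfl⟩ := hx
    obtain ⟨y, _, hy, rfl, rfl⟩ := hy
    rw [hT x y hx hy (by simpa [mul_assoc] using hxy)]
  · intro i hi
    simp only [Finset.mem_map, Equiv.coe_toEmbedding] at hi
    obtain ⟨j, hj, rfl⟩ := hi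
    exact h _ (hTE j hj)

/-- On this line the rewired walk is the original one, so the coordinates are values of `z` at the
distinct points `ga ^ k` and `ga ^ k * gb`. -/
theorem indepOn_aline_one : IndepOn κ (aline 1) := by
  intro T _ hTE t
  let f : ℤ × Bool → F2 := fun i => cond i.2 (ga ^ i.1 * gb) (ga ^ i.1)
  let j : ℤ × Bool → F2 × Bool := fun i => (ga ^ i.1, i.2)
  have hj : Function.Injective j := by
    rintro ⟨k, c⟩ ⟨l, d⟩ h
    simp only [j, Prod.mk.injEq] at h
    exact Prod.ext (a_zpow_injective h.1) h.2
  have hne : ∀ k l : ℤ, ga ^ k ≠ ga ^ l * gb := by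
    intro k l h
    have : gb = ga ^ (k - l) := by
      rw [sub_eq_neg_add, zpow_add, h, zpow_neg, inv_mul_cancel_left]
    exact a_zpow_notMem_branch (d := true) (k - l) (this ▸ b_mem_branch)
  have hf : Function.Injective f := by
    rintro ⟨k, _ | _⟩ ⟨l, _ | _⟩ h
    · exact Prod.ext (a_zpow_injective h) rfl
    · exact absurd h (hne k l)
    · exact absurd h.symm (hne l k)
    · exact Prod.ext (a_zpow_injective (mul_right_cancel h)) rfl
  have hT : ∀ i ∈ T, i ∈ Set.range j := by
    intro i hi
    obtain ⟨k, hk⟩ := hTE i hi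
    exact ⟨(k, i.2), by simp only [j]; rw [← one_mul (ga ^ k), ← hk]⟩
  have hmap := Measure.map_infinitePi_infinitePi_of_inj (P := fun _ : F2 => κ) hf
  have hpre : rewiredPair ⁻¹' box T t = (fun (z : F2 → K) i => z (f i)) ⁻¹'
      Set.pi (T.preimage j hj.injOn : Set (ℤ × Bool)) (t ∘ j) := by
    have hc : ∀ (i : ℤ × Bool) (z : F2 → K), coord (j i) (rewiredPair z) = z (f i) := by
      rintro ⟨k, _ | _⟩ z <;>
        simp [coord, j, f, rewiredPair, rewire, pos_a_zpow, edgePair]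
    ext z
    simp only [box, Set.mem_preimage, Set.mem_ofPred_eq, Set.mem_pi, Finset.coe_preimage,
      Finset.mem_coe, ← hc, Function.comp_apply]
    constructor
    · exact fun h i hi => h _ hi
    · intro h i hi
      obtain ⟨i, rfl⟩ := hT i hi
      exact h i hi
  rw [rewiredMeasure, Measure.map_apply measurable_rewiredPair (measurableSet_box _ _), hpre,
    ← Measure.map_apply (by fun_prop) (MeasurableSet.pi (Finset.countable_toSet _)
      fun _ _ => .of_discrete), hmap, Measure.infinitePi_pi _ fun _ _ => .of_discrete]
  exact Finset.prod_preimage j T hj.injOn (fun i => κ (t i)) fun i hi hi' => absurd (hT i hi) hi'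

theorem indepOn_aline (g : F2) : IndepOn κ (aline g) := by
  refine indepOn_aline_one.translate g⁻¹ ?_
  rintro _ ⟨k, rfl⟩
  exact ⟨k, by simp⟩

/-- Given `z q = k`, the event `e` becomes one on `S` alone, independent of `f` and `z q` jointly.
Since `f` is independent of `z q`, summing over `k` factorises. -/
theorem infinitePi_inter_of_shared {e f : Set (F2 → K)} (he : MeasurableSet e)
    (hf : MeasurableSet f) {S T : Set F2} {q : F2} (hST : Disjoint S T) (hq : q ∈ T)
    (heS : DependsOn (· ∈ e) (insert q S)) (hfT : DependsOn (· ∈ f) T)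
    (h : ∀ k, Measure.infinitePi (fun _ : F2 => κ) (f ∩ {z | z q = k}) =
      κ {k} * Measure.infinitePi (fun _ : F2 => κ) f) :
    Measure.infinitePi (fun _ : F2 => κ) (e ∩ f) =
      Measure.infinitePi (fun _ : F2 => κ) e * Measure.infinitePi (fun _ : F2 => κ) f := by
  classical
  set μ := Measure.infinitePi (fun _ : F2 => κ) with hμ
  have hfib : ∀ k, MeasurableSet {z : F2 → K | z q = k} := fun k =>
    (measurable_pi_apply (X := fun _ : F2 => K) q) (measurableSet_singleton k)
  have hqS : q ∉ S := fun h' => Set.disjoint_left.1 hST h' hq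
  have hdep : ∀ k, DependsOn (· ∈ {z : F2 → K | z q = k}) T := by
    intro k x y hxy
    simp only [Set.mem_ofPred_eq, hxy q hq]
  have hκ : ∀ k, μ {z | z q = k} = κ {k} := by
    intro k
    rw [← Measure.infinitePi_map_eval (fun _ : F2 => κ) q,
      Measure.map_apply (measurable_pi_apply q) (measurableSet_singleton k)]
    rfl
  rw [measure_eq_tsum_inter_fiber μ (fun z => z q) hfib (he.inter hf),
    measure_eq_tsum_inter_fiber μ (fun z => z q) hfib he, ← ENNReal.tsum_mul_right]
  refine tsum_congr fun k => ?_
  have hek : MeasurableSet {z : F2 → K | Function.update z q k ∈ e} :=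
    measurable_update_left he
  have hekS : DependsOn (· ∈ {z : F2 → K | Function.update z q k ∈ e}) S := by
    intro x y hxy
    refine heS fun i hi => ?_
    by_cases hiq : i = q
    · rw [hiq, Function.update_self, Function.update_self]
    · rw [Function.update_of_ne hiq, Function.update_of_ne hiq]
      exact hxy i (hi.resolve_left hiq)
  have heq : e ∩ {z | z q = k} = {z : F2 → K | Function.update z q k ∈ e} ∩ {z | z q = k} := by
    ext z
    refine and_congr_left fun hz => ?_
    have hz' : z q = k := hz
    rw [Set.mem_ofPred_eq, ← hz', Function.update_eq_self]
  rw [Set.inter_right_comm, heq, Set.inter_assoc, Set.inter_comm _ f,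
    hμ, infinitePi_inter_of_dependsOn κ hek (hf.inter (hfib k)) hST hekS,
    infinitePi_inter_of_dependsOn κ hek (hfib k) hST hekS (hdep k), ← hμ, h, hκ, mul_assoc]
  intro x y hxy
  simp only [Set.mem_inter_iff]
  have h1 := hfT hxy
  have h2 := hdep k hxy
  simp only at h1 h2
  rw [h1, h2]

theorem dependsOn_rewiredPair_turn_of_mem {g : F2} (hg : g ∈ branch true) :
    DependsOn (fun z : F2 → K => rewiredPair (turn z) g) (branch true) := by
  intro x y h
  have hp : ∀ p, (p ∈ branch true ↔ g ∈ branch true) → edgePair x p = edgePair y p := by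
    intro p hp
    have hp := hp.2 hg
    rw [edgePair, edgePair, h p hp, h _ (mul_b_mem hp)]
  simp only
  rw [rewiredPair_turn, rewiredPair_turn, hp _ (pos_mirror_mem_branch _ g), pos_mirror_congr hp]

/-- A pair looks one `gb`-edge ahead; from outside the branch this enters it only at `gb`, the
single shared coordinate. -/
theorem dependsOn_rewiredPair_turn_of_notMem {g : F2} (hg : g ∉ branch true) :
    DependsOn (fun z : F2 → K => rewiredPair (turn z) g) (insert gb (branch true)ᶜ) := by
  intro x y h
  have hp : ∀ p, (p ∈ branch true ↔ g ∈ branch true) → edgePair x p = edgePair y p := by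
    intro p hp
    have hp := mt hp.1 hg
    rw [edgePair, edgePair, h p (Or.inr hp), h (p * gb) ?_]
    by_cases hpb : p * gb ∈ branch true
    · left; rw [eq_one_of_mul_b_mem hp hpb, one_mul]
    · exact Or.inr hpb
  simp only
  rw [rewiredPair_turn, rewiredPair_turn, hp _ (pos_mirror_mem_branch _ g), pos_mirror_congr hp]

theorem dependsOn_box {T : Finset (F2 × Bool)} {t : F2 × Bool → Set K} {S : Set F2}
    (h : ∀ i ∈ T, DependsOn (fun z : F2 → K => rewiredPair (turn z) i.1) S) :
    DependsOn (· ∈ {z : F2 → K | rewiredPair (turn z) ∈ box T t}) S := by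
  intro x y hxy
  simp only [box, Set.mem_ofPred_eq, eq_iff_iff]
  exact forall₂_congr fun i hi => by rw [coord_congr (h i hi hxy)]

theorem rewiredMeasure_inter_box {T T' : Finset (F2 × Bool)} (t t' : F2 × Bool → Set K)
    {S R : Set F2} (hSR : Disjoint S R) (hR : gb ∈ R)
    (hT : ∀ i ∈ T, DependsOn (fun z : F2 → K => rewiredPair (turn z) i.1) (insert gb S))
    (hT' : ∀ i ∈ T', DependsOn (fun z : F2 → K => rewiredPair (turn z) i.1) R)
    {y : F2} (hy : ∀ᵐ z ∂(Measure.infinitePi fun _ : F2 => κ), (rewiredPair (turn z) y).1 = z gb)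
    (hyT' : (y, false) ∉ T') (hline : ∀ i ∈ T', i.1 ∈ aline y) :
    rewiredMeasure κ (box T t ∩ box T' t') =
      rewiredMeasure κ (box T t) * rewiredMeasure κ (box T' t') := by
  classical
  have hQ : MeasurePreserving (fun z => rewiredPair (turn z))
      (Measure.infinitePi fun _ : F2 => κ) (rewiredMeasure κ) :=
    (measurePreserving_rewiredPair κ).comp (measurePreserving_turn κ)
  have hm := measurableSet_box T t
  have hm' := measurableSet_box T' t'
  rw [← hQ.measure_preimage hm.nullMeasurableSet, ← hQ.measure_preimage hm'.nullMeasurableSet,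
    ← hQ.measure_preimage (hm.inter hm').nullMeasurableSet]
  refine infinitePi_inter_of_shared (hQ.measurable hm) (hQ.measurable hm') hSR hR
    (dependsOn_box hT) (dependsOn_box hT') fun k => ?_
  change Measure.infinitePi (fun _ : F2 => κ)
    (((fun z => rewiredPair (turn z)) ⁻¹' box T' t') ∩ {z | z gb = k}) =
    κ {k} * Measure.infinitePi (fun _ : F2 => κ) ((fun z => rewiredPair (turn z)) ⁻¹' box T' t')
  set t'' := Function.update t' (y, false) {k} with ht''
  -- Fixing `z gb` amounts almost surely to one more constraint, on the first entry at `y`, so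
  -- independence along the line of `y` applies.
  have hbox : (((fun z => rewiredPair (turn z)) ⁻¹' box T' t') ∩ {z | z gb = k} : Set (F2 → K))
      =ᵐ[Measure.infinitePi fun _ : F2 => κ]
      (fun z => rewiredPair (turn z)) ⁻¹' box (insert (y, false) T') t'' := by
    filter_upwards [hy] with z hz
    apply propext
    change (_ ∧ z gb = k) ↔ _
    simp only [Set.mem_preimage, box, Set.mem_ofPred_eq, Finset.forall_mem_insert]
    rw [and_comm]
    refine and_congr ?_ (forall₂_congr fun i hi => ?_)
    · rw [ht'', Function.update_self, ← hz]; rfl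
    · rw [ht'', Function.update_of_ne (ne_of_mem_of_not_mem hi hyT')]
  have hline' : ∀ i ∈ insert (y, false) T', i.1 ∈ aline y := by
    intro i hi
    rcases Finset.mem_insert.1 hi with rfl | hi
    · exact self_mem_aline y
    · exact hline i hi
  rw [measure_congr hbox, hQ.measure_preimage (measurableSet_box _ _).nullMeasurableSet,
    hQ.measure_preimage hm'.nullMeasurableSet,
    indepOn_aline y _ (admissible_of_subset_aline hline') hline',
    indepOn_aline y _ (admissible_of_subset_aline hline) hline, Finset.prod_insert hyT', ht'',
    Function.update_self]
  congr 1
  refine Finset.prod_congr rfl fun i hi => ?_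
  rw [Function.update_of_ne (ne_of_mem_of_not_mem hi hyT')]

theorem IndepOn.union_aline {E : Set F2} (hE : IndepOn κ E) {x y : F2} (hx : x ∈ E)
    (hdisj : Disjoint E (aline y)) (hxy : x⁻¹ * y ∈ Subgroup.zpowers gb)
    (hae : ∀ᵐ w ∂rewiredMeasure κ, (w x).1 = (w y).1)
    (hind : ∀ (T T' : Finset (F2 × Bool)) (t t' : F2 × Bool → Set K), (∀ i ∈ T, i.1 ∈ E) →
      (∀ i ∈ T', i.1 ∈ aline y) → (y, false) ∉ T' → rewiredMeasure κ (box T t ∩ box T' t') =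
      rewiredMeasure κ (box T t) * rewiredMeasure κ (box T' t')) :
    IndepOn κ (E ∪ aline y) := by
  classical
  have key : ∀ T : Finset (F2 × Bool), Admissible T → (∀ i ∈ T, i.1 ∈ E ∪ aline y) →
      (y, false) ∉ T → ∀ t : F2 × Bool → Set K, rewiredMeasure κ (box T t) = ∏ i ∈ T, κ (t i) := by
    intro T hT hTE hy t
    set T₁ := T.filter fun i => i.1 ∈ E with hT₁
    set T₂ := T.filter fun i => i.1 ∉ E with hT₂
    have h1 : ∀ i ∈ T₁, i.1 ∈ E := fun i hi => (Finset.mem_filter.1 hi).2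
    have h2 : ∀ i ∈ T₂, i.1 ∈ aline y := fun i hi =>
      (hTE i (Finset.mem_filter.1 hi).1).resolve_left (Finset.mem_filter.1 hi).2
    have hbox : box T t = box T₁ t ∩ box T₂ t := by
      ext w
      simp only [box, Set.mem_inter_iff, Set.mem_ofPred_eq, hT₁, hT₂, Finset.mem_filter]
      constructor
      · exact fun h => ⟨fun i hi => h i hi.1, fun i hi => h i hi.1⟩
      · intro h i hi
        by_cases hiE : i.1 ∈ E
        exacts [h.1 i ⟨hi, hiE⟩, h.2 i ⟨hi, hiE⟩]
    rw [hbox, hind T₁ T₂ t t h1 h2 fun h => hy (Finset.mem_filter.1 h).1,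
      hE T₁ (hT.mono (Finset.filter_subset _ _)) h1,
      indepOn_aline y T₂ (hT.mono (Finset.filter_subset _ _)) h2,
      Finset.prod_filter_mul_prod_filter_not]
  intro T hT hTE t
  by_cases hy : (y, false) ∈ T
  · have hne : x ≠ y := fun h => Set.disjoint_left.1 hdisj hx (h ▸ self_mem_aline y)
    have hxT : (x, false) ∉ T := fun h => hne (hT x y h hy hxy)
    -- The first entries at `x` and `y` agree almost surely, so the constraint at `y` is moved to
    -- `x`. Admissibility of `T` leaves no other first entry of this coset constrained.
    set T' := insert (x, false) (T.erase (y, false)) with hT'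
    set t' := Function.update t (x, false) (t (y, false)) with ht'
    have hx' : (x, false) ∉ T.erase (y, false) := fun h => hxT (Finset.mem_of_mem_erase h)
    have hbox : box T t =ᵐ[rewiredMeasure κ] box T' t' := by
      filter_upwards [hae] with w hw
      apply propext
      change (∀ i ∈ T, coord i w ∈ t i) ↔ ∀ i ∈ T', coord i w ∈ t' i
      rw [← Finset.insert_erase hy, hT', Finset.forall_mem_insert, Finset.forall_mem_insert]
      refine and_congr ?_ (forall₂_congr fun i hi => ?_)
      · rw [ht', Function.update_self]
        change (w y).1 ∈ _ ↔ (w x).1 ∈ _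
        rw [hw]
      · rw [ht', Function.update_of_ne (ne_of_mem_of_not_mem hi hx')]
    have hcos : ∀ g, g⁻¹ * y ∈ Subgroup.zpowers gb ↔ g⁻¹ * x ∈ Subgroup.zpowers gb := by
      intro g
      have : g⁻¹ * y = g⁻¹ * x * (x⁻¹ * y) := by group
      rw [this, Subgroup.mul_mem_cancel_right _ hxy]
    have hxg : ∀ g, (g, false) ∈ T.erase (y, false) → g⁻¹ * x ∉ Subgroup.zpowers gb := by
      intro g hg h
      have := hT g y (Finset.mem_of_mem_erase hg) hy ((hcos g).2 h)
      rw [this] at hg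
      exact Finset.notMem_erase _ _ hg
    rw [measure_congr hbox, key T' ?_ ?_ ?_ t', hT', Finset.prod_insert hx', ht',
      Function.update_self, ← Finset.mul_prod_erase T _ hy]
    · congr 1
      refine Finset.prod_congr rfl fun i hi => ?_
      rw [Function.update_of_ne (ne_of_mem_of_not_mem hi hx')]
    · intro g h hg hh hgh
      rcases Finset.mem_insert.1 hg with hg | hg <;> rcases Finset.mem_insert.1 hh with hh | hh
      · exact (Prod.ext_iff.1 hg).1.trans (Prod.ext_iff.1 hh).1.symm
      · rw [show g = x from (Prod.ext_iff.1 hg).1, ← inv_mem_iff, mul_inv_rev, inv_inv] at hgh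
        exact absurd hgh (hxg h hh)
      · rw [show h = x from (Prod.ext_iff.1 hh).1] at hgh
        exact absurd hgh (hxg g hg)
      · exact hT g h (Finset.mem_of_mem_erase hg) (Finset.mem_of_mem_erase hh) hgh
    · intro i hi
      rcases Finset.mem_insert.1 hi with rfl | hi
      · exact Or.inl hx
      · exact hTE i (Finset.mem_of_mem_erase hi)
    · intro h
      rcases Finset.mem_insert.1 h with h | h
      · exact hne (Prod.ext_iff.1 h).1.symm
      · exact Finset.notMem_erase _ _ h
  · exact key T hT hTE hy t

theorem IndepOn.union_aline_b {E : Set F2} (hE : IndepOn κ E) (h1 : 1 ∈ E)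
    (hb : ∀ x ∈ E, x ∉ branch true) : IndepOn κ (E ∪ aline gb) := by
  have hline : ∀ x ∈ aline gb, x ∈ branch true := by
    rintro _ ⟨k, rfl⟩
    exact (mul_a_zpow_mem_branch k).2 b_mem_branch
  refine hE.union_aline h1 (Set.disjoint_left.2 fun x hx hx' => hb x hx (hline x hx'))
    (by simp) ?_ ?_
  · filter_upwards [ae_rewired_fst κ 1] with w hw
    rw [← hw, one_mul]
  · intro T T' t t' hT hT' hyT'
    refine rewiredMeasure_inter_box t t' (S := (branch true)ᶜ) (R := branch true)
      disjoint_compl_left b_mem_branch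
      (fun i hi => dependsOn_rewiredPair_turn_of_notMem (hb _ (hT i hi)))
      (fun i hi => dependsOn_rewiredPair_turn_of_mem (hline _ (hT' i hi))) ?_ hyT' hT'
    refine Filter.Eventually.of_forall fun z => ?_
    rw [rewiredPair_turn, pos_b_mirror_one, edgePair]

theorem IndepOn.union_aline_one {E : Set F2} (hE : IndepOn κ E) (h1 : gb ∈ E)
    (hb : ∀ x ∈ E, x ∈ branch true) : IndepOn κ (E ∪ aline 1) := by
  have hline : ∀ x ∈ aline 1, x ∉ branch true := by
    rintro _ ⟨k, rfl⟩
    rw [one_mul]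
    exact a_zpow_notMem_branch k
  refine hE.union_aline h1 (Set.disjoint_left.2 fun x hx hx' => hline x hx' (hb x hx))
    (by simp) ?_ ?_
  · filter_upwards [ae_rewired_fst κ 1] with w hw
    rw [← hw, one_mul]
  · intro T T' t t' hT hT' hyT'
    refine rewiredMeasure_inter_box t t' (S := branch true \ {gb}) (R := insert gb (branch true)ᶜ)
      ?_ (Set.mem_insert _ _) (fun i hi => ?_)
      (fun i hi => dependsOn_rewiredPair_turn_of_notMem (hline _ (hT' i hi))) ?_ hyT' hT'
    · rw [Set.disjoint_left]
      rintro x ⟨hx, hxb⟩ (h | h)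
      exacts [hxb h, h hx]
    · rw [Set.insert_sdiff_singleton, Set.insert_eq_of_mem b_mem_branch]
      exact dependsOn_rewiredPair_turn_of_mem (hb _ (hT i hi))
    -- Here the new line is that of `1`. After `turn` the first entry at `1` is `z` at the mirror
    -- image, almost surely the second entry at `1`, which is `z gb`.
    · filter_upwards [ae_edgePair_mirror κ 1] with z hz
      rw [rewiredPair_turn, pos_one, hz, edgePair, one_mul]
      rfl

end Edge

/-! ### Exhaustion by convex sets and identification of the law -/

/-- A union of left cosets of `⟨ga⟩` that is connected in the Cayley tree: a `gb`-edge leaving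
the set separates it from the branch beyond the edge. -/
structure IsConvex (E : Set F2) : Prop where
  mul_a_zpow : ∀ h ∈ E, ∀ k : ℤ, h * ga ^ k ∈ E
  notMem_branch : ∀ h ∈ E, ∀ d, h * bsign d ∉ E → ∀ e ∈ E, h⁻¹ * e ∉ branch d

theorem isConvex_aline_one : IsConvex (aline 1) where
  mul_a_zpow := by
    rintro _ ⟨j, rfl⟩ k
    exact ⟨j + k, by rw [zpow_add, mul_assoc]⟩
  notMem_branch := by
    rintro _ ⟨j, rfl⟩ d _ _ ⟨k, rfl⟩
    have : (1 * ga ^ j)⁻¹ * (1 * ga ^ k) = ga ^ (-j + k) := by simp [zpow_add]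
    rw [this]
    exact a_zpow_notMem_branch _

theorem IsConvex.union_aline {E : Set F2} (hE : IsConvex E) {g : F2} (hg : g ∈ E) {d : Bool}
    (hgd : g * bsign d ∉ E) : IsConvex (E ∪ aline (g * bsign d)) where
  mul_a_zpow := by
    rintro h (h' | ⟨j, rfl⟩) k
    · exact Or.inl (hE.mul_a_zpow h h' k)
    · exact Or.inr ⟨j + k, by rw [zpow_add]; simp only [mul_assoc]⟩
  notMem_branch := by
    rintro h (h' | ⟨j, rfl⟩) c hc e (he | ⟨k, rfl⟩)
    · exact hE.notMem_branch h h' c (fun h => hc (Or.inl h)) e he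
    · rw [← mul_assoc, mul_a_zpow_mem_branch, ← mul_assoc]
      intro hmem
      obtain ⟨h1, rfl⟩ := eq_one_of_mul_bsign_mem
        (hE.notMem_branch h h' c (fun h => hc (Or.inl h)) g hg) hmem
      rw [inv_mul_eq_one] at h1
      rw [h1] at hc
      exact hc (Or.inr (self_mem_aline _))
    -- Seen from the new line, the old set lies beyond the edge back to `g`, and that edge does not
    -- leave the union.
    · intro hmem
      have h1 : bsign (!d) * (g⁻¹ * e) ∈ branch (!d) :=
        bsign_mul_mem_branch (by rw [Bool.not_not]; exact hE.notMem_branch g hg d hgd e he)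
      have h2 : (g * bsign d * ga ^ j)⁻¹ * e = ga ^ (-j) * (bsign (!d) * (g⁻¹ * e)) := by
        rw [bsign_not, zpow_neg]; group
      rw [h2] at hmem
      obtain ⟨h3, rfl⟩ := a_zpow_mul_branch h1 hmem
      rw [neg_eq_zero] at h3
      apply hc
      left
      rw [h3, zpow_zero, mul_one, bsign_not, mul_inv_cancel_right]
      exact hg
    · have : (g * bsign d * ga ^ j)⁻¹ * (g * bsign d * ga ^ k) = ga ^ (-j + k) := by
        rw [zpow_add, zpow_neg]; group
      rw [this]
      exact a_zpow_notMem_branch _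

section Exhaustion

variable {K : Type*} [Countable K] [MeasurableSpace K] [MeasurableSingletonClass K]
  {κ : Measure K} [IsProbabilityMeasure κ]

/-- A translation carries the connecting edge to the one from `1` to `gb`, with `g` going to `1` or
to `gb` according to `d`; convexity puts the translate of `E` on one side. -/
theorem IndepOn.union_aline_bsign {E : Set F2} (hE : IndepOn κ E) (hconv : IsConvex E) {g : F2}
    (hg : g ∈ E) {d : Bool} (hgd : g * bsign d ∉ E) :
    IndepOn κ (E ∪ aline (g * bsign d)) := by
  have hsep := hconv.notMem_branch g hg d hgd
  cases d with
  | true =>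
    rw [bsign_true]
    have h : IndepOn κ ({x | g * x ∈ E} ∪ aline gb) := by
      refine IndepOn.union_aline_b (hE.translate g fun x hx => hx) ?_ ?_
      · rw [Set.mem_ofPred_eq, mul_one]; exact hg
      · intro x hx
        simpa using hsep _ hx
    refine h.translate g⁻¹ ?_
    rintro x (hx | ⟨k, rfl⟩)
    · left; rw [Set.mem_ofPred_eq, mul_inv_cancel_left]; exact hx
    · right; exact ⟨k, by group⟩
  | false =>
    rw [bsign_false]
    have h : IndepOn κ ({x | g * gb⁻¹ * x ∈ E} ∪ aline 1) := by
      refine IndepOn.union_aline_one (hE.translate (g * gb⁻¹) fun x hx => hx) ?_ ?_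
      · rw [Set.mem_ofPred_eq, inv_mul_cancel_right]; exact hg
      · intro x hx
        have h1 := bsign_mul_mem_branch (d := true) (hsep _ hx)
        rw [bsign_true] at h1
        convert h1 using 1
        group
    refine h.translate (g * gb⁻¹)⁻¹ ?_
    rintro x (hx | ⟨k, rfl⟩)
    · left; rw [Set.mem_ofPred_eq, mul_inv_cancel_left]; exact hx
    · right; exact ⟨k, by group⟩

theorem exists_indepOn_insert (g : F2) {E : Set F2} (hE : IndepOn κ E) (hconv : IsConvex E)
    (h1 : 1 ∈ E) : ∃ E', E ⊆ E' ∧ g ∈ E' ∧ IndepOn κ E' ∧ IsConvex E' := by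
  have step : ∀ (g : F2) (d : Bool), (∃ E', E ⊆ E' ∧ g ∈ E' ∧ IndepOn κ E' ∧ IsConvex E') →
      ∃ E', E ⊆ E' ∧ g * bsign d ∈ E' ∧ IndepOn κ E' ∧ IsConvex E' := by
    rintro g d ⟨E', hEE, hg, hE', hc⟩
    by_cases hgd : g * bsign d ∈ E'
    · exact ⟨E', hEE, hgd, hE', hc⟩
    · exact ⟨_, hEE.trans Set.subset_union_left, Or.inr (self_mem_aline _),
        hE'.union_aline_bsign hc hg hgd, hc.union_aline hg hgd⟩
  induction g using F2.induction_right with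
  | one => exact ⟨E, subset_rfl, h1, hE, hconv⟩
  | mul_a g ih =>
    obtain ⟨E', hEE, hg, hE', hc⟩ := ih
    exact ⟨E', hEE, by simpa using hc.mul_a_zpow g hg 1, hE', hc⟩
  | mul_a_inv g ih =>
    obtain ⟨E', hEE, hg, hE', hc⟩ := ih
    exact ⟨E', hEE, by simpa using hc.mul_a_zpow g hg (-1), hE', hc⟩
  | mul_b g ih => exact step g true ih
  | mul_b_inv g ih => exact step g false ih

theorem exists_indepOn_superset (s : Finset F2) :
    ∃ E, (∀ g ∈ s, g ∈ E) ∧ 1 ∈ E ∧ IndepOn κ E ∧ IsConvex E := by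
  classical
  induction s using Finset.induction_on with
  | empty => exact ⟨aline 1, by simp, self_mem_aline 1, indepOn_aline_one, isConvex_aline_one⟩
  | insert g s _ ih =>
    obtain ⟨E, hs, h1, hE, hc⟩ := ih
    obtain ⟨E', hEE, hg, hE', hc'⟩ := exists_indepOn_insert g hE hc h1
    refine ⟨E', ?_, hEE h1, hE', hc'⟩
    intro x hx
    rcases Finset.mem_insert.1 hx with rfl | hx
    exacts [hg, hEE (hs x hx)]

theorem indepOn_univ : IndepOn κ Set.univ := by
  classical
  intro T hT _ t
  obtain ⟨E, hs, -, hE, -⟩ := exists_indepOn_superset (κ := κ) (T.image Prod.fst)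
  exact hE T hT (fun i hi => hs _ (Finset.mem_image_of_mem _ hi)) t

/-- The values of a labelling on coset representatives and its second coordinates. -/
noncomputable def cosetCoords {K : Type*} (w : F2 → K × K)
    (i : (F2 ⧸ Subgroup.zpowers gb) ⊕ F2) : K :=
  Sum.elim (fun c => (w c.out).1) (fun g => (w g).2) i

theorem measurable_cosetCoords : Measurable (cosetCoords : (F2 → K × K) → _ → K) := by
  refine measurable_pi_lambda _ fun i => ?_
  obtain c | g := i
  · exact measurable_fst.comp (measurable_pi_apply c.out)
  · exact measurable_snd.comp (measurable_pi_apply g)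

theorem map_cosetCoords :
    (rewiredMeasure κ).map cosetCoords = Measure.infinitePi fun _ => κ := by
  refine Measure.eq_infinitePi _ fun s t _ => ?_
  let j : (F2 ⧸ Subgroup.zpowers gb) ⊕ F2 → F2 × Bool :=
    Sum.elim (fun c => (c.out, false)) (fun g => (g, true))
  let r : F2 × Bool → (F2 ⧸ Subgroup.zpowers gb) ⊕ F2 :=
    fun i => cond i.2 (Sum.inr i.1) (Sum.inl (i.1 : F2 ⧸ Subgroup.zpowers gb))
  have hrj : ∀ i, r (j i) = i := by
    rintro (c | g)
    · simp [r, j]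
    · rfl
  have hj : Function.Injective j := Function.LeftInverse.injective hrj
  rw [Measure.map_apply measurable_cosetCoords
    (MeasurableSet.pi (Finset.countable_toSet _) fun _ _ => .of_discrete)]
  have hpre : cosetCoords ⁻¹' Set.pi (s : Set ((F2 ⧸ Subgroup.zpowers gb) ⊕ F2)) t =
      box (s.map ⟨j, hj⟩) (t ∘ r) := by
    have hc : ∀ i (w : F2 → K × K), coord (j i) w = cosetCoords w i := by
      rintro (c | g) w <;> rfl
    ext w
    rw [Set.mem_preimage, Set.mem_pi, box, Set.mem_ofPred_eq, Finset.forall_mem_map]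
    refine forall₂_congr fun i _ => ?_
    rw [Function.Embedding.coeFn_mk, hc, Function.comp_apply, hrj]
  rw [hpre, indepOn_univ _ ?_ (fun _ _ => Set.mem_univ _)]
  · simp [hrj]
  · intro g h hg hh hgh
    obtain ⟨i, _, hi⟩ := Finset.mem_map.1 hg
    obtain ⟨i', _, hi'⟩ := Finset.mem_map.1 hh
    simp only [Function.Embedding.coeFn_mk] at hi hi'
    have h1 := hrj i
    have h2 := hrj i'
    rw [hi] at h1
    rw [hi'] at h2
    have h3 : r (g, false) = r (h, false) := by
      simp only [r, cond_false, Sum.inl.injEq]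
      exact QuotientGroup.eq.2 hgh
    rw [h1, h2] at h3
    rw [h3, hi'] at hi
    exact (Prod.ext_iff.1 hi).1.symm

theorem ae_fst_eq_of_coset_eq : ∀ᵐ w ∂rewiredMeasure κ, ∀ g h : F2,
    (g : F2 ⧸ Subgroup.zpowers gb) = h → (w g).1 = (w h).1 := by
  filter_upwards [ae_all_iff.2 fun g => ae_rewired_fst κ g] with w hw g h hgh
  obtain ⟨k, hk⟩ := Subgroup.mem_zpowers_iff.1 (QuotientGroup.eq.1 hgh)
  have : ∀ k : ℤ, (w (g * gb ^ k)).1 = (w g).1 := by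
    intro k
    induction k using Int.induction_on with
    | zero => simp
    | succ k ih => rw [zpow_add_one, ← mul_assoc, hw, ih]
    | pred k ih =>
      have := hw (g * gb ^ (-(k : ℤ) - 1))
      rw [mul_assoc, ← zpow_add_one, sub_add_cancel, ih] at this
      exact this.symm
  rw [← this k, hk, mul_inv_cancel_left]

theorem rewiredMeasure_eq_cosetMeasure :
    rewiredMeasure κ = cosetMeasure (Subgroup.zpowers gb) κ := by
  set A := F2 ⧸ Subgroup.zpowers gb
  let f : (A ⊕ F2 → K) → (F2 → K × K) := fun v g => (v (Sum.inl (g : A)), v (Sum.inr g))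
  have hf : Measurable f := measurable_pi_lambda _ fun g =>
    (measurable_pi_apply (Sum.inl (g : A))).prodMk (measurable_pi_apply (Sum.inr g))
  let e : (A → K) × (F2 → K) → (A ⊕ F2 → K) := fun p => Sum.elim p.1 p.2
  have he : Measurable e := by
    refine measurable_pi_lambda _ fun i => ?_
    obtain c | g := i
    · exact (measurable_pi_apply c).comp measurable_fst
    · exact (measurable_pi_apply g).comp measurable_snd
  have hprod : ((Measure.infinitePi fun _ : A => κ).prod (Measure.infinitePi fun _ : F2 => κ)).map e
      = Measure.infinitePi fun _ => κ := by
    refine Measure.eq_infinitePi _ fun s t _ => ?_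
    have hpre : e ⁻¹' Set.pi (s : Set (A ⊕ F2)) t =
        Set.pi (s.toLeft : Set A) (fun c => t (Sum.inl c)) ×ˢ
          Set.pi (s.toRight : Set F2) (fun g => t (Sum.inr g)) := by
      ext p
      simp [e, Set.mem_pi]
    rw [Measure.map_apply he (MeasurableSet.pi (Finset.countable_toSet _) fun _ _ => .of_discrete),
      hpre, Measure.prod_prod, Measure.infinitePi_pi _ fun _ _ => .of_discrete,
      Measure.infinitePi_pi _ fun _ _ => .of_discrete]
    conv_rhs => rw [← Finset.toLeft_disjSum_toRight (u := s), Finset.prod_disjSum]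
  have h1 : cosetMeasure (Subgroup.zpowers gb) κ =
      (Measure.infinitePi fun _ : A ⊕ F2 => κ).map f := by
    rw [← hprod, Measure.map_map hf he]
    rfl
  rw [h1, ← map_cosetCoords, Measure.map_map hf measurable_cosetCoords]
  conv_lhs => rw [← Measure.map_id (μ := rewiredMeasure κ)]
  -- First entries are almost surely constant on cosets, so `w` is recovered from their values at
  -- representatives.
  refine Measure.map_congr ?_
  filter_upwards [ae_fst_eq_of_coset_eq (κ := κ)] with w hw
  funext g
  refine Prod.ext (hw g _ ?_) rfl
  simp

end Exhaustion

/-! ### The orbit equivalence -/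

section OrbitEquivalence

variable {K : Type*}

theorem edgePair_fst_of_mem_range {u : F2 → K × K} (h : ∀ g, (u g).2 = (u (g * gb)).1) :
    edgePair (fun g => (u g).1) = u :=
  funext fun g => Prod.ext rfl (h g).symm

end OrbitEquivalence

theorem theorem1p3 {K : Type*} [Countable K] [MeasurableSpace K] [MeasurableSingletonClass K]
    (κ : Measure K) [IsProbabilityMeasure κ] :
    OrbitEquivalent (bernoulliShift (FreeGroup (Fin 2)) κ)
      (cosetShift (Subgroup.zpowers (FreeGroup.of (1 : Fin 2))) κ) := by
  have hν : cosetMeasure (Subgroup.zpowers (FreeGroup.of (1 : Fin 2))) κ = rewiredMeasure κ :=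
    rewiredMeasure_eq_cosetMeasure.symm
  -- Since `rewire` is an involution, this condition, that `rewire w` comes from a labelling by `K`,
  -- describes exactly the range of `rewiredPair`.
  let Y : Set (F2 → K × K) := {w | ∀ g, (rewire w g).2 = (rewire w (g * gb)).1}
  have hYW : ∀ z : F2 → K, rewiredPair z ∈ Y := by
    intro z g
    rw [rewiredPair, rewire_rewire]
    rfl
  have hback : ∀ w ∈ Y, rewiredPair (fun g => (rewire w g).1) = w := by
    intro w hw
    rw [rewiredPair, edgePair_fst_of_mem_range hw, rewire_rewire]
  have hYm : MeasurableSet Y := by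
    have : Y = ⋂ g, {w | (rewire w g).2 = (rewire w (g * gb)).1} := by ext; simp [Y]
    rw [this]
    refine MeasurableSet.iInter fun g => measurableSet_eq_fun ?_ ?_
    · exact measurable_snd.comp ((measurable_pi_apply g).comp measurable_rewire)
    · exact measurable_fst.comp ((measurable_pi_apply (g * gb)).comp measurable_rewire)
  have hYc : cosetMeasure (Subgroup.zpowers (FreeGroup.of (1 : Fin 2))) κ Yᶜ = 0 := by
    rw [hν, rewiredMeasure, Measure.map_apply measurable_rewiredPair hYm.compl]
    convert measure_empty (μ := Measure.infinitePi (fun _ : F2 => κ))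
    rw [Set.eq_empty_iff_forall_notMem]
    exact fun z hz => hz (hYW z)
  have horbit : ∀ (z : F2 → K) (h : F2), ∃ g : F2,
      rewiredPair (shift g z) = shift h (rewiredPair z) := by
    intro z h
    refine ⟨(pos (edgePair z) h⁻¹ 1)⁻¹, ?_⟩
    rw [rewiredPair, edgePair_shift, rewire_shift_pos, inv_inv, rewiredPair]
  let φ : (Set.univ : Set (F2 → K)) ≃ᵐ Y :=
    { toFun := fun z => ⟨rewiredPair z.1, hYW z.1⟩
      invFun := fun w => ⟨fun g => (rewire w.1 g).1, trivial⟩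
      left_inv := by
        intro z
        apply Subtype.ext
        change (fun g => (rewire (rewire (edgePair z.1)) g).1) = z.1
        rw [rewire_rewire]
        rfl
      right_inv := fun w => Subtype.ext (hback w.1 w.2)
      measurable_toFun := (measurable_rewiredPair.comp measurable_subtype_coe).subtype_mk
      measurable_invFun := by
        refine Measurable.subtype_mk (measurable_pi_lambda _ fun g => ?_)
        exact measurable_fst.comp
          ((measurable_pi_apply g).comp (measurable_rewire.comp measurable_subtype_coe)) }
  refine ⟨Set.univ, Y, φ, MeasurableSet.univ, hYm, by simp, hYc, fun _ _ _ => trivial, ?_, ?_, ?_⟩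
  · intro h w hw
    obtain ⟨g, hg⟩ := horbit (fun g => (rewire w g).1) h
    rw [hback w hw] at hg
    change shift h w ∈ Y
    rw [← hg]
    exact hYW _
  · refine ⟨φ.measurable, ?_⟩
    ext S hS
    have hS' : MeasurableSet (Subtype.val '' S) := hYm.subtype_image hS
    rw [Measure.map_apply φ.measurable hS, comap_subtype_coe_apply hYm, hν, rewiredMeasure,
      Measure.map_apply measurable_rewiredPair hS', comap_subtype_coe_apply MeasurableSet.univ]
    congr 1
    ext z
    constructor
    · rintro ⟨z, hz, rfl⟩
      exact ⟨φ z, hz, rfl⟩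
    · rintro ⟨w, hw, hwz⟩
      refine ⟨⟨z, trivial⟩, ?_, rfl⟩
      have : φ ⟨z, trivial⟩ = w := Subtype.ext hwz.symm
      rw [Set.mem_preimage, this]
      exact hw
  · intro z
    ext w
    constructor
    · rintro ⟨z', ⟨g, hg⟩, rfl⟩
      -- Every vertex is reached by a rewired path from the base point.
      obtain ⟨h, hh⟩ := (⟨_, pos_pos_rewire (edgePair z.1) g⁻¹⟩ : ∃ h, pos (edgePair z.1) h 1 = g⁻¹)
      refine ⟨h⁻¹, ?_⟩
      change shift h⁻¹ (rewire (edgePair z.1)) = rewire (edgePair z'.1)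
      rw [← rewire_shift_pos, hh, inv_inv, ← edgePair_shift]
      exact congrArg (fun x => rewire (edgePair x)) hg
    · rintro ⟨h, rfl⟩
      obtain ⟨g, hg⟩ := horbit z.1 h
      exact ⟨⟨shift g z.1, trivial⟩, ⟨g, rfl⟩, hg⟩
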